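/- Let $M$ be a connected smooth manifold of dimension $n\ge 2$ and let $F\colon TM\to\mathbb R$ be a Finsler metric: $F$ is continuous and non-negative, smooth away from the zero section, positively homogeneous of degree one on each tangent space, zero exactly on zero vectors, and the vertical Hessian $g_{ij}=\partial^2 (F^2/2)/\partial y^i\partial y^j$ is positive definite at all non-zero tangent vectors. Assume that $F$ is non-Riemannian (i.e. it is not the case that $F^2$ is a quadratic form on every tangent space). Let $\nabla$ be a linear connection on $M$ which is compatible with $F$ (its parallel transports preserve the $F$-length of tangent vectors) and semi-symmetric: its torsion is $T(X,Y)=\rho(Y)X-\rho(X)Y$ for a 1-form $\rho$. Let $\gamma$ be the averaged Riemannian metric, $\gamma_q(X,Y)=\int_{\{F_q=1\}} g(X,Y)\,\mu_q$ for $q\in M$, where $\mu_q$ is the Riemannian hypersurface measure induced by $g_{ij}$ on the indicatrix $\{F_q=1\}\subset T_qM$. Let $p\in M$, let $u^1,\dots,u^n$ be normal coordinates around $p$ with respect to $\gamma$, let $(x^i,y^i)$ be the induced coordinates on $TM$, and write tangent vectors at $p$ by their coordinates $v=[v^1,\dots,v^n]$. Put $$f_{ji}=y^j\frac{\partial F}{\partial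 y^i}-y^i\frac{\partial F}{\partial y^j},\qquad f^h_{ji}=y^j\frac{\partial F}{\partial x^i}-y^i\frac{\partial F}{\partial x^j}.$$ A non-zero $v\in T_pM$ is called vertical contact if $[\partial F/\partial y^1(v),\dots,\partial F/\partial y^n(v)]$ is parallel to $v$. Then $T_pM$ contains a non-zero vector that is not vertical contact. For every non-zero $v\in T_pM$ that is not vertical contact there are indices $i,j$ with $f_{ji}(v)\ne 0$, and for every such $v$ and all such $i,j$ the following hold. 1. There is $r>0$ such that $f_{ji}\neq 0$ on the closed ball of radius $r$ around $v$ in $T_pM$. 2. Let $\tilde v=v^1+\dots+v^n$, let $\varepsilon\in\mathbb R\setminus\{0,\tilde v\}$, and let $w_l=[v^1,\dots,v^{l-1},v^l-\varepsilon,v^{l+1},\dots,v^n]$ for $l=1,\dots,n$. If $f_{ji}(w_l)\neq0$ for all $l$ (by 1., this holds whenever $|\varepsilon|\le r$), then the components $\rho_k=\rho_p(\partial/\partial u^k)$ are $$\rho_k=\frac1\varepsilon\left(\frac1{\tilde v-\varepsilon}\sum_{l=1}^n v^l\,\frac{f^h_{ji}}{f_{ji}}(w_l)-\frac{f^h_{ji}}{f_{ji}}(w_k)\right)\qquad(k=1,\dots,n).$$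 -/

import Mathlib

open Set Filter Topology MeasureTheory
open scoped Manifold ContDiff

noncomputable section

/-- The `i`-th standard basis vector of `ℝⁿ`. -/
def stdVec (n : ℕ) (i : Fin n) : EuclideanSpace ℝ (Fin n) := EuclideanSpace.single i 1

/-- The `i`-th partial derivative of a function on `ℝⁿ`. -/
def pderiv {n : ℕ} (i : Fin n) (f : EuclideanSpace ℝ (Fin n) → ℝ)
    (x : EuclideanSpace ℝ (Fin n)) : ℝ :=
  fderiv ℝ f x (stdVec n i)

section FinslerDefs

variable {n : ℕ} {M : Type*} [TopologicalSpace M] [ChartedSpace (EuclideanSpace ℝ (Fin n)) M]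

/-! ### Finsler metrics -/

/-- The restriction of a function on `TM` to the tangent space at `p`
(which Mathlib models on `ℝⁿ`). -/
def fiberFun (F : TangentBundle (𝓡 n) M → ℝ) (p : M) (y : EuclideanSpace ℝ (Fin n)) : ℝ :=
  F ⟨p, y⟩

/-- The vertical Hessian `g_y(v, w)` of the energy `E = F² / 2` on the tangent space at `p`. -/
def vertHess (F : TangentBundle (𝓡 n) M → ℝ) (p : M) (y v w : EuclideanSpace ℝ (Fin n)) : ℝ :=
  fderiv ℝ (fun y' => fderiv ℝ (fun y'' => fiberFun F p y'' ^ 2 / 2) y' w) y v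

/-- Finsler metrics: non-negative continuous functions on `TM`, smooth away from the zero section,
positively homogeneous, definite and strongly convex. -/
structure IsFinslerMetric [IsManifold (𝓡 n) ∞ M] (F : TangentBundle (𝓡 n) M → ℝ) : Prop where
  nonneg : ∀ v, 0 ≤ F v
  continuous : Continuous F
  smooth : ContMDiffOn (𝓡 n).tangent 𝓘(ℝ, ℝ) ∞ F {v | v.snd ≠ 0}
  homogeneous : ∀ (p : M) (y : TangentSpace (𝓡 n) p) (t : ℝ), 0 < t → F ⟨p, t • y⟩ = t * F ⟨p, y⟩
  definite : ∀ (p : M) (y : TangentSpace (𝓡 n) p), F ⟨p, y⟩ = 0 ↔ y = 0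
  convex : ∀ (p : M) (y v : EuclideanSpace ℝ (Fin n)), y ≠ 0 → v ≠ 0 → 0 < vertHess F p y v v

/-- `F` is Riemannian if on every tangent space `F²` is the quadratic form of a symmetric bilinear
form. Positive definiteness of the forms and their smooth dependence on the base point are
automatic for a Finsler metric. -/
def IsRiemannianFinsler (F : TangentBundle (𝓡 n) M → ℝ) : Prop :=
  ∀ p : M, ∃ B : LinearMap.BilinForm ℝ (TangentSpace (𝓡 n) p),
    B.IsSymm ∧ ∀ y : TangentSpace (𝓡 n) p, F ⟨p, y⟩ ^ 2 = B y y

/-! ### The averaged Riemannian metric -/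

/-- The density `√(det g_ij)` on the punctured tangent space at `p`. -/
def sqrtDet (F : TangentBundle (𝓡 n) M → ℝ) (p : M) (y : EuclideanSpace ℝ (Fin n)) : ℝ :=
  Real.sqrt (Matrix.det (Matrix.of fun i j => vertHess F p y (stdVec n i) (stdVec n j)))

/-- The Riemannian hypersurface measure `μ` induced by `g_ij` on the indicatrix
`{y | F(p, y) = 1}`. The `g`-unit normal of the indicatrix is the radial field `C`, hence `μ` is
given by the form `ι_C (√det g dy¹ ∧ … ∧ dyⁿ)`; as `√det g` is constant along rays, the measure of
`A` is `n` times the `√det g dy`-volume of the cone `{t a | a ∈ A, 0 < t ≤ 1}` over `A`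
(compare `MeasureTheory.Measure.toSphere`). -/
def indicatrixMeasure (F : TangentBundle (𝓡 n) M → ℝ) (p : M) :
    Measure (EuclideanSpace ℝ (Fin n)) :=
  n • Measure.map (fun y => (fiberFun F p y)⁻¹ • y)
    ((volume.restrict {y | fiberFun F p y ≤ 1}).withDensity
      fun y => ENNReal.ofReal (sqrtDet F p y))

/-- The averaged Riemannian metric `γ_p(v, w) = ∫ g_y(v, w) dμ(y)` over the indicatrix at `p`. -/
def averagedMetric (F : TangentBundle (𝓡 n) M → ℝ) (p : M)
    (v w : TangentSpace (𝓡 n) p) : ℝ :=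
  ∫ y, vertHess F p y v w ∂(indicatrixMeasure F p)

/-! ### Local coordinates -/

/-- The coordinate vector field `∂/∂uⁱ` of the chart `φ` (meaningful on `φ.source`): the vector
whose image under the differential of `φ` is the `i`-th standard basis vector. -/
def coordField (φ : OpenPartialHomeomorph M (EuclideanSpace ℝ (Fin n))) (i : Fin n) (x : M) :
    TangentSpace (𝓡 n) x :=
  VectorField.mpullback (𝓡 n) (𝓡 n) φ (fun _ => stdVec n i) x

/-- The coordinates `(y¹, …, yⁿ)` of a tangent vector in the chart `φ`. -/
def vecCoord (φ : OpenPartialHomeomorph M (EuclideanSpace ℝ (Fin n))) (v : TangentBundle (𝓡 n) M) :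
    EuclideanSpace ℝ (Fin n) :=
  mfderiv (𝓡 n) (𝓡 n) φ v.proj v.snd

/-- `F` in the induced coordinates `(x, y)` of the tangent manifold. -/
def localF (F : TangentBundle (𝓡 n) M → ℝ)
    (φ : OpenPartialHomeomorph M (EuclideanSpace ℝ (Fin n)))
    (x y : EuclideanSpace ℝ (Fin n)) : ℝ :=
  F ⟨φ.symm x, mfderiv (𝓡 n) (𝓡 n) φ.symm x y⟩

/-- The horizontal partial derivative `∂F/∂xⁱ` at `(x, y)`. -/
def dx (F : TangentBundle (𝓡 n) M → ℝ) (φ : OpenPartialHomeomorph M (EuclideanSpace ℝ (Fin n)))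
    (i : Fin n) (x y : EuclideanSpace ℝ (Fin n)) : ℝ :=
  pderiv i (fun x' => localF F φ x' y) x

/-- The vertical partial derivative `∂F/∂yⁱ` at `(x, y)`. -/
def dy (F : TangentBundle (𝓡 n) M → ℝ) (φ : OpenPartialHomeomorph M (EuclideanSpace ℝ (Fin n)))
    (i : Fin n) (x y : EuclideanSpace ℝ (Fin n)) : ℝ :=
  pderiv i (fun y' => localF F φ x y') y

/-- `f_ij = yⁱ ∂F/∂yʲ - yʲ ∂F/∂yⁱ` at the tangent vector at `p` with coordinates `y`. -/
def fVert (F : TangentBundle (𝓡 n) M → ℝ) (φ : OpenPartialHomeomorph M (EuclideanSpace ℝ (Fin n)))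
    (p : M) (i j : Fin n) (y : EuclideanSpace ℝ (Fin n)) : ℝ :=
  y i * dy F φ j (φ p) y - y j * dy F φ i (φ p) y

/-- `f^h_ij = yⁱ ∂F/∂xʲ - yʲ ∂F/∂xⁱ` at the tangent vector at `p` with coordinates `y`. -/
def fHor (F : TangentBundle (𝓡 n) M → ℝ) (φ : OpenPartialHomeomorph M (EuclideanSpace ℝ (Fin n)))
    (p : M) (i j : Fin n) (y : EuclideanSpace ℝ (Fin n)) : ℝ :=
  y i * dx F φ j (φ p) y - y j * dx F φ i (φ p) y

/-- In coordinates that are orthonormal at `p`: a non-zero tangent vector with coordinates `y` is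
not a vertical contact vector if `G = (∂F/∂y¹, …, ∂F/∂yⁿ)` and `C = (y¹, …, yⁿ)` are linearly
independent there. -/
def NotVertContact (F : TangentBundle (𝓡 n) M → ℝ)
    (φ : OpenPartialHomeomorph M (EuclideanSpace ℝ (Fin n)))
    (p : M) (y : EuclideanSpace ℝ (Fin n)) : Prop :=
  y ≠ 0 ∧ LinearIndependent ℝ
    ![(fun i => dy F φ i (φ p) y : Fin n → ℝ), (fun i => y i : Fin n → ℝ)]

/-- The components `γ_ij` of a metric in the chart `φ`. -/
def metricCoeff (γ : (p : M) → TangentSpace (𝓡 n) p → TangentSpace (𝓡 n) p → ℝ)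
    (φ : OpenPartialHomeomorph M (EuclideanSpace ℝ (Fin n))) (i j : Fin n)
    (x : EuclideanSpace ℝ (Fin n)) : ℝ :=
  γ (φ.symm x) (mfderiv (𝓡 n) (𝓡 n) φ.symm x (stdVec n i))
    (mfderiv (𝓡 n) (𝓡 n) φ.symm x (stdVec n j))

/-- The Christoffel symbols `Γ*ᵏ_ij` of the Levi-Civita connection of a metric. -/
def leviCivitaSymbol (γ : (p : M) → TangentSpace (𝓡 n) p → TangentSpace (𝓡 n) p → ℝ)
    (φ : OpenPartialHomeomorph M (EuclideanSpace ℝ (Fin n))) (k i j : Fin n)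
    (x : EuclideanSpace ℝ (Fin n)) : ℝ :=
  (1 / 2) * ∑ l, (Matrix.of fun a b => metricCoeff γ φ a b x)⁻¹ k l *
    (pderiv i (metricCoeff γ φ j l) x + pderiv j (metricCoeff γ φ i l) x
      - pderiv l (metricCoeff γ φ i j) x)

/-- `φ` is a normal coordinate system around `p` with respect to the Riemannian metric `γ`: the
coordinate basis at `p` is orthonormal, and the straight lines `t ↦ t a` through the origin of the
(star-shaped) coordinate domain are geodesics. -/
structure IsNormalChart [IsManifold (𝓡 n) ∞ M]
    (γ : (p : M) → TangentSpace (𝓡 n) p → TangentSpace (𝓡 n) p → ℝ)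
    (φ : OpenPartialHomeomorph M (EuclideanSpace ℝ (Fin n))) (p : M) : Prop where
  mem_atlas : φ ∈ IsManifold.maximalAtlas (𝓡 n) ∞ M
  mem_source : p ∈ φ.source
  center : φ p = 0
  star : StarConvex ℝ 0 φ.target
  orthonormal : ∀ i j, metricCoeff γ φ i j 0 = if i = j then 1 else 0
  geodesic : ∀ (a : EuclideanSpace ℝ (Fin n)) (t : ℝ), t • a ∈ φ.target →
    ∀ k, ∑ i, ∑ j, leviCivitaSymbol γ φ k i j (t • a) * a i * a j = 0

/-! ### Linear connections -/

/-- The Christoffel symbols `Γᵏ_ij` of a linear connection in the chart `φ`: the `k`-th coordinate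
of `∇_{∂/∂uⁱ} ∂/∂uʲ` (in Mathlib, `∇ Y x (X x)` is `(∇_X Y)(x)`). -/
def connSymbol [IsManifold (𝓡 n) ∞ M]
    (cov : CovariantDerivative (𝓡 n) (EuclideanSpace ℝ (Fin n)) (TangentSpace (𝓡 n) : M → Type _))
    (φ : OpenPartialHomeomorph M (EuclideanSpace ℝ (Fin n))) (k i j : Fin n) (x : M) : ℝ :=
  vecCoord φ ⟨x, cov (coordField φ j) x (coordField φ i x)⟩ k

/-- The vector field `V` along the curve `t ↦ (V t).proj` is parallel on the open set `s`: around
each parameter, `dVᵏ/dt + Γᵏ_ij (dcⁱ/dt) Vʲ = 0` in some chart (equivalently, in every chart). -/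
def IsParallelOn [IsManifold (𝓡 n) ∞ M]
    (cov : CovariantDerivative (𝓡 n) (EuclideanSpace ℝ (Fin n)) (TangentSpace (𝓡 n) : M → Type _))
    (V : ℝ → TangentBundle (𝓡 n) M) (s : Set ℝ) : Prop :=
  ∀ t ∈ s, ∃ φ ∈ IsManifold.maximalAtlas (𝓡 n) ∞ M, (V t).proj ∈ φ.source ∧
    ∀ k, HasDerivAt (fun τ => vecCoord φ (V τ) k)
      (-∑ i, ∑ j, connSymbol cov φ k i j (V t).proj *
        deriv (fun τ => φ (V τ).proj i) t * vecCoord φ (V t) j) t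

/-- The linear connection is compatible with `F`: parallel transport along smooth curves preserves
the Finslerian length of tangent vectors. -/
def IsCompatible [IsManifold (𝓡 n) ∞ M] (F : TangentBundle (𝓡 n) M → ℝ)
    (cov : CovariantDerivative (𝓡 n) (EuclideanSpace ℝ (Fin n))
      (TangentSpace (𝓡 n) : M → Type _)) : Prop :=
  ∀ (V : ℝ → TangentBundle (𝓡 n) M) (a b : ℝ),
    ContMDiffOn 𝓘(ℝ, ℝ) (𝓡 n) ∞ (fun t => (V t).proj) (Ioo a b) →
    IsParallelOn cov V (Ioo a b) →
    ∀ s ∈ Ioo a b, ∀ t ∈ Ioo a b, F (V s) = F (V t)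

/-- The torsion of the linear connection is `T(X, Y) = ρ(Y) X - ρ(X) Y`. -/
def HasSemiSymmetricTorsion [IsManifold (𝓡 n) ∞ M]
    (cov : CovariantDerivative (𝓡 n) (EuclideanSpace ℝ (Fin n)) (TangentSpace (𝓡 n) : M → Type _))
    (ρ : (x : M) → TangentSpace (𝓡 n) x →L[ℝ] ℝ) : Prop :=
  ∀ (x : M) (X Y : TangentSpace (𝓡 n) x), cov.torsion x X Y = ρ x Y • X - ρ x X • Y

end FinslerDefs

end

/-! Compatibility makes parallel transport a linear isometry between the fibres of `F`. Transport
along coordinate rays from `x₀` gives matrices `A x` with `A x₀ = 1`, derivative `-Γ` at `x₀`, and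
`F(x, A x y) = F(x₀, y)` (`exists_isometric_transport`). Differentiability at the centre alone
suffices, so smooth dependence of ODE solutions on parameters is never needed.

The isometries have two consequences. Differentiating `F(x, A x y)` gives `∂F/∂xⁱ = Γᵏ_ij yʲ ∂F/∂yᵏ`
(`dx_eq_sum`). The averaged metric is built naturally from `F`, so the same maps preserve it, and
hence it is parallel (`pderiv_metricCoeff`). At the centre of normal coordinates its Levi-Civita
symbols vanish, so its first derivatives vanish and `Γᵏ_ij` is skew in `k, j`. With the
semi-symmetric torsion, Koszul's argument yields `Γᵏ_ij = ρ_j δ_ki - ρ_k δ_ij`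
(`symbol_eq_of_skew_of_torsion`).

Substituting, `∂F/∂xⁱ = ρ(y) ∂F/∂yⁱ - yⁱ Σ ρ_k ∂F/∂yᵏ`. The last term cancels under
antisymmetrization, so `f^h_ji = ρ(y) f_ji` (`fHor_eq_mul_fVert`). The quotients at the `w_l` are
therefore the values `ρ(w_l) = ρ(v) - ε ρ_l`, a linear system solved in `linear_component_eq`.

If every non-zero vector at `p` were vertical contact, Euler's relation would make `F² / |y|²`
constant on the connected punctured space, and `F²` would be quadratic at `p`. The isometries spread
this over the connected manifold, contradicting that `F` is non-Riemannian
(`exists_notVertContact`). -/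

noncomputable section

/-! ### Linear ODEs and radial transport with first-order expansion. -/

section LinearODE

open scoped NNReal

variable {E : Type*} [NormedAddCommGroup E] [NormedSpace ℝ E]

/-- Fundamental solution of a linear ODE whose coefficient is small on `[-2, 2]`. -/
theorem exists_fundamental_solution [CompleteSpace E] {T : ℝ → E →L[ℝ] E} {c : ℝ} (hc : 0 ≤ c)
    (hc' : 4 * c ≤ 1) (hT : ContinuousOn T (Icc (-2) 2)) (hTc : ∀ t ∈ Icc (-2 : ℝ) 2, ‖T t‖ ≤ c) :
    ∃ B : ℝ → E →L[ℝ] E, B 0 = 1 ∧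
      ∀ t ∈ Ioo (-2 : ℝ) 2, HasDerivAt B (T t * B t) t ∧ ‖B t - 1‖ ≤ 4 * c := by
  have h0 : (0 : ℝ) ∈ Icc (-2 : ℝ) 2 := by norm_num
  have hone : ‖(1 : E →L[ℝ] E)‖ ≤ 1 := ContinuousLinearMap.norm_id_le
  have hL : ((2 * c).toNNReal : ℝ) = 2 * c := Real.coe_toNNReal _ (by positivity)
  -- Picard–Lindelöf on the closed unit ball around the identity: there `‖B‖ ≤ 2`, so the speed is
  -- at most `2c`, and over a time of at most `2` the solution stays inside because `4c ≤ 1`. The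
  -- interval `[-2, 2]` keeps both `0` and `1` interior.
  have hf : IsPicardLindelof (fun t B => T t * B) (⟨0, h0⟩ : Icc (-2 : ℝ) 2) (1 : E →L[ℝ] E)
      1 0 (2 * c).toNNReal c.toNNReal := by
    refine ⟨fun t ht => ?_, fun x _ => ?_, fun t ht x hx => ?_, ?_⟩
    · refine LipschitzWith.lipschitzOnWith (LipschitzWith.of_dist_le_mul fun x y => ?_)
      rw [dist_eq_norm, dist_eq_norm, ← mul_sub]
      refine (norm_mul_le _ _).trans ?_
      rw [Real.coe_toNNReal _ hc]
      exact mul_le_mul_of_nonneg_right (hTc t ht) (norm_nonneg _)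
    · exact hT.mul continuousOn_const
    · have hx2 : ‖x‖ ≤ 2 := by
        have h1 : ‖x - 1‖ ≤ 1 := by simpa [dist_eq_norm] using hx
        have h2 := norm_add_le (x - 1) 1
        rw [sub_add_cancel] at h2
        linarith
      refine (norm_mul_le _ _).trans ?_
      rw [hL]
      nlinarith [hTc t ht, norm_nonneg (T t), norm_nonneg x]
    · rw [hL]
      norm_num
      linarith
  have hmem : (1 : E →L[ℝ] E) ∈ Metric.closedBall (1 : E →L[ℝ] E) ((0 : ℝ≥0) : ℝ) := by simp
  obtain ⟨α, hα⟩ := ODE.FunSpace.exists_isFixedPt_next hf hmem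
  have hval : ∀ t (ht : t ∈ Icc (-2 : ℝ) 2), α.compProj t =
      ODE.picard (fun t B => T t * B) 0 1 α.compProj t := by
    intro t ht
    rw [ODE.FunSpace.compProj_of_mem ht, ← hα, ODE.FunSpace.next_apply, hα]
  have hα0 : α.compProj 0 = 1 := by rw [hval 0 h0, ODE.picard_apply₀]
  refine ⟨α.compProj, hα0, fun t ht => ⟨?_, ?_⟩⟩
  · have htI := Ioo_subset_Icc_self ht
    have := (ODE.hasDerivWithinAt_picard_Icc h0 hf.continuousOn_uncurry
      α.continuous_compProj.continuousOn
      (fun _ _ => α.compProj_mem_closedBall hf.mul_max_le) 1 htI).congr_of_mem hval htI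
    exact this.hasDerivAt (Icc_mem_nhds ht.1 ht.2)
  · have htI := Ioo_subset_Icc_self ht
    have h := α.lipschitzWith.dist_le_mul ⟨t, htI⟩ ⟨0, h0⟩
    rw [← ODE.FunSpace.compProj_of_mem htI, ← ODE.FunSpace.compProj_of_mem h0, hα0,
      dist_eq_norm, Subtype.dist_eq, Real.dist_eq, hL] at h
    refine h.trans ?_
    have : |t - 0| ≤ 2 := by rw [sub_zero, abs_le]; exact htI
    nlinarith

/-- First-order expansion at time one of a fundamental solution. -/
theorem norm_fundamental_solution_sub_le {T B : ℝ → E →L[ℝ] E} {T₀ : E →L[ℝ] E} {c e : ℝ}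
    (hB0 : B 0 = 1) (hB : ∀ t ∈ Icc (0 : ℝ) 1, HasDerivAt B (T t * B t) t)
    (hB1 : ∀ t ∈ Icc (0 : ℝ) 1, ‖B t - 1‖ ≤ 4 * c) (hT : ∀ t ∈ Icc (0 : ℝ) 1, ‖T t‖ ≤ c)
    (hTe : ∀ t ∈ Icc (0 : ℝ) 1, ‖T t - T₀‖ ≤ e) :
    ‖B 1 - 1 - T₀‖ ≤ 4 * c ^ 2 + e := by
  -- Subtracting the linear motion `t • T₀` leaves the velocity `T (B - 1) + (T - T₀)`, which is
  -- small in both terms.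
  have hderiv : ∀ t ∈ Icc (0 : ℝ) 1,
      HasDerivWithinAt (fun t => B t - t • T₀) (T t * B t - T₀) (Icc 0 1) t := fun t ht => by
    have := (hB t ht).fun_sub ((hasDerivAt_id t).smul_const T₀)
    simpa using this.hasDerivWithinAt
  have hbound : ∀ t ∈ Ico (0 : ℝ) 1, ‖T t * B t - T₀‖ ≤ 4 * c ^ 2 + e := fun t ht => by
    have ht' := Ico_subset_Icc_self ht
    have h1 : T t * B t - T₀ = T t * (B t - 1) + (T t - T₀) := by
      rw [mul_sub, mul_one]; abel
    rw [h1]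
    refine (norm_add_le _ _).trans (add_le_add ((norm_mul_le _ _).trans ?_) (hTe t ht'))
    nlinarith [hB1 t ht', hT t ht', norm_nonneg (T t), norm_nonneg (B t - 1)]
  have := norm_image_sub_le_of_norm_deriv_le_segment' hderiv hbound 1 (by norm_num)
  simpa [hB0, sub_right_comm] using this

/-- Parallel transport along the rays issuing from `x₀`, for the connection with Christoffel
symbol `G`, together with its first-order expansion. -/
theorem exists_radial_transport [CompleteSpace E] {G : E → E →L[ℝ] E →L[ℝ] E} {x₀ : E} {U : Set E}
    (hU : U ∈ 𝓝 x₀) (hG : ContinuousOn G U) :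
    ∃ A : E → E →L[ℝ] E, A x₀ = 1 ∧ HasFDerivAt A (-G x₀) x₀ ∧
      ∀ᶠ x in 𝓝 x₀, ∃ B : ℝ → E →L[ℝ] E, B 0 = 1 ∧ B 1 = A x ∧
        ∀ t ∈ Ioo (-2 : ℝ) 2, x₀ + t • (x - x₀) ∈ U ∧
          HasDerivAt B (-(G (x₀ + t • (x - x₀)) (x - x₀) * B t)) t := by
  have hGx : ContinuousAt G x₀ := hG.continuousAt hU
  set C : ℝ := ‖G x₀‖ + 1 with hC
  have hCpos : 0 < C := by positivity
  obtain ⟨η, hη, hball⟩ : ∃ η > 0, ∀ x, ‖x - x₀‖ < η → x ∈ U ∧ ‖G x‖ ≤ C := by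
    have h1 : ∀ᶠ x in 𝓝 x₀, ‖G x‖ < C := 
      (ContinuousAt.norm (E := E →L[ℝ] E →L[ℝ] E) hGx).eventually_lt_const (by simp [hC])
    obtain ⟨η, hη, h⟩ := Metric.eventually_nhds_iff.1 (h1.and hU)
    exact ⟨η, hη, fun x hx => ⟨(h (by rwa [dist_eq_norm])).2, (h (by rwa [dist_eq_norm])).1.le⟩⟩
  -- The first bound keeps `x₀ + t • a` within `η` for `|t| ≤ 2`. The second gives `4 * (C * ‖a‖) ≤
  -- 1`, the smallness needed for a fundamental solution.
  set δ : ℝ := min (η / 3) (1 / (4 * C)) with hδ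
  have hδpos : 0 < δ := by positivity
  have hseg : ∀ a : E, ‖a‖ < δ → ∀ t ∈ Icc (-2 : ℝ) 2, ‖(x₀ + t • a) - x₀‖ < η := by
    intro a ha t ht
    have h1 : ‖a‖ < η / 3 := ha.trans_le (min_le_left _ _)
    have h2 : |t| ≤ 2 := abs_le.2 ht
    rw [add_sub_cancel_left, norm_smul, Real.norm_eq_abs]
    nlinarith [norm_nonneg a, abs_nonneg t]
  have hex : ∀ a : E, ‖a‖ < δ → ∃ B : ℝ → E →L[ℝ] E, B 0 = 1 ∧ ∀ t ∈ Ioo (-2 : ℝ) 2,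
      HasDerivAt B (-(G (x₀ + t • a) a) * B t) t ∧ ‖B t - 1‖ ≤ 4 * (C * ‖a‖) := by
    intro a ha
    refine exists_fundamental_solution (T := fun t => -(G (x₀ + t • a) a)) (by positivity) ?_ ?_ ?_
    · have h1 : ‖a‖ < 1 / (4 * C) := ha.trans_le (min_le_right _ _)
      rw [lt_div_iff₀ (by positivity)] at h1
      linarith
    · refine ContinuousOn.neg (ContinuousOn.clm_apply ?_ continuousOn_const)
      exact hG.comp (by fun_prop) fun t ht => (hball _ (hseg a ha t ht)).1
    · intro t ht
      rw [norm_neg]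
      exact (G _).le_of_opNorm_le (hball _ (hseg a ha t ht)).2 a
  choose! B hB0 hB using hex
  refine ⟨fun x => B (x - x₀) 1, ?_, ?_, ?_⟩
  · have h := (hB 0 (by simpa using hδpos) 1 (by norm_num)).2
    simpa [sub_eq_zero] using h
  · have hB1 : B (x₀ - x₀) 1 = 1 := by
      have h := (hB 0 (by simpa using hδpos) 1 (by norm_num)).2
      simpa [sub_eq_zero] using h
    rw [hasFDerivAt_iff_isLittleO, Asymptotics.isLittleO_iff]
    intro ε hε
    have h1 : ∀ᶠ x in 𝓝 x₀, ‖G x - G x₀‖ < ε / 2 := by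
      have : Tendsto (fun x => ‖G x - G x₀‖) (𝓝 x₀) (𝓝 ‖G x₀ - G x₀‖) :=
        ContinuousAt.norm (E := E →L[ℝ] E →L[ℝ] E) (hGx.sub continuousAt_const)
      exact this.eventually_lt_const 
        (by rw [sub_self]; exact ContinuousLinearMap.opNorm_zero.trans_lt (half_pos hε))
    obtain ⟨r, hr, hr'⟩ := Metric.eventually_nhds_iff.1 h1
    -- The last radius makes the quadratic error `4 (C ‖x - x₀‖)²` at most `ε / 2 * ‖x - x₀‖`; the
    -- continuity of `G` accounts for the other half.
    filter_upwards [Metric.ball_mem_nhds x₀ hδpos, Metric.ball_mem_nhds x₀ hr,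
      Metric.ball_mem_nhds x₀ (show 0 < ε / (8 * C ^ 2) by positivity)] with x hx1 hx2 hx3
    rw [mem_ball_iff_norm] at hx1 hx2 hx3
    rw [hB1]
    have hI : ∀ t ∈ Icc (0 : ℝ) 1, t ∈ Ioo (-2 : ℝ) 2 := fun t ht =>
      ⟨by linarith [ht.1], by linarith [ht.2]⟩
    have key := norm_fundamental_solution_sub_le (T₀ := -(G x₀ (x - x₀)))
      (T := fun t => -(G (x₀ + t • (x - x₀)) (x - x₀)))
      (c := C * ‖x - x₀‖) (e := ε / 2 * ‖x - x₀‖) (hB0 _ hx1)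
      (fun t ht => (hB _ hx1 t (hI t ht)).1) (fun t ht => (hB _ hx1 t (hI t ht)).2)
      (fun t ht => by
        rw [norm_neg]
        exact (G _).le_of_opNorm_le (hball _ (hseg _ hx1 t (Ioo_subset_Icc_self (hI t ht)))).2 _)
      (fun t ht => by
        rw [neg_sub_neg, ← norm_neg, neg_sub, ← sub_apply]
        refine ContinuousLinearMap.le_of_opNorm_le _ (hr' ?_).le _
        rw [dist_eq_norm, add_sub_cancel_left, norm_smul, Real.norm_eq_abs, abs_of_nonneg ht.1]
        nlinarith [ht.2, norm_nonneg (x - x₀)])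
    refine key.trans ?_
    rw [lt_div_iff₀ (by positivity)] at hx3
    nlinarith [norm_nonneg (x - x₀)]
  · filter_upwards [Metric.ball_mem_nhds x₀ hδpos] with x hx
    rw [mem_ball_iff_norm] at hx
    refine ⟨B (x - x₀), hB0 _ hx, rfl, fun t ht => ⟨?_, ?_⟩⟩
    · exact (hball _ (hseg _ hx t (Ioo_subset_Icc_self ht))).1
    · rw [← neg_mul]
      exact (hB _ hx t ht).1

end LinearODE

/-! ### Charts: smoothness of `F` and of coordinate fields. -/

theorem two_le_infty : (2 : WithTop ℕ∞) ≤ ∞ := WithTop.coe_le_coe.2 le_top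

theorem contMDiff_tangentBundle_mk (E : Type*) [NormedAddCommGroup E] [NormedSpace ℝ E] :
    ContMDiff 𝓘(ℝ, E × E) 𝓘(ℝ, E).tangent ∞ (fun z : E × E => (⟨z.1, z.2⟩ : TangentBundle 𝓘(ℝ, E) E)) := by
  intro z
  rw [Bundle.contMDiffAt_totalSpace]
  refine ⟨contDiff_fst.contMDiff z, ?_⟩
  simpa using contDiff_snd.contMDiff z

section Charts

variable {n : ℕ} {M : Type*} [TopologicalSpace M] [ChartedSpace (EuclideanSpace ℝ (Fin n)) M]
  {φ : OpenPartialHomeomorph M (EuclideanSpace ℝ (Fin n))}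

theorem mdifferentiable_of_mem_maximalAtlas (hφ : φ ∈ IsManifold.maximalAtlas (𝓡 n) ∞ M) :
    φ.MDifferentiable (𝓡 n) (𝓡 n) :=
  ⟨(contMDiffOn_of_mem_maximalAtlas hφ).mdifferentiableOn (by simp),
    (contMDiffOn_symm_of_mem_maximalAtlas hφ).mdifferentiableOn (by simp)⟩

/-- The differential of the inverse of a chart, as a linear isomorphism. -/
def chartSymmEquiv (hφ : φ ∈ IsManifold.maximalAtlas (𝓡 n) ∞ M) {x : EuclideanSpace ℝ (Fin n)}
    (hx : x ∈ φ.target) : EuclideanSpace ℝ (Fin n) ≃L[ℝ] EuclideanSpace ℝ (Fin n) :=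
  (mdifferentiable_of_mem_maximalAtlas hφ).symm.mfderiv hx

theorem localF_eq_fiberFun (hφ : φ ∈ IsManifold.maximalAtlas (𝓡 n) ∞ M)
    (F : TangentBundle (𝓡 n) M → ℝ) {x : EuclideanSpace ℝ (Fin n)} (hx : x ∈ φ.target)
    (y : EuclideanSpace ℝ (Fin n)) :
    localF F φ x y = fiberFun F (φ.symm x) (chartSymmEquiv hφ hx y) := rfl

theorem vecCoord_mfderiv_symm (hφ : φ ∈ IsManifold.maximalAtlas (𝓡 n) ∞ M)
    {x : EuclideanSpace ℝ (Fin n)} (hx : x ∈ φ.target) (y : EuclideanSpace ℝ (Fin n)) :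
    vecCoord φ ⟨φ.symm x, mfderiv (𝓡 n) (𝓡 n) φ.symm x y⟩ = y :=
  congrArg (fun L => L y) ((mdifferentiable_of_mem_maximalAtlas hφ).comp_symm_deriv hx)

theorem isInvertible_mfderiv_chart (hφ : φ ∈ IsManifold.maximalAtlas (𝓡 n) ∞ M) {q : M}
    (hq : q ∈ φ.source) : (mfderiv (𝓡 n) (𝓡 n) φ q).IsInvertible :=
  ⟨(mdifferentiable_of_mem_maximalAtlas hφ).mfderiv hq, rfl⟩

theorem vecCoord_coordField (hφ : φ ∈ IsManifold.maximalAtlas (𝓡 n) ∞ M) {q : M}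
    (hq : q ∈ φ.source) (i : Fin n) : vecCoord φ ⟨q, coordField φ i q⟩ = stdVec n i :=
  ContinuousLinearMap.IsInvertible.self_apply_inverse (isInvertible_mfderiv_chart hφ hq) _

theorem vecCoord_sub (φ : OpenPartialHomeomorph M (EuclideanSpace ℝ (Fin n))) {q : M}
    (v w : TangentSpace (𝓡 n) q) : vecCoord φ ⟨q, v - w⟩ = vecCoord φ ⟨q, v⟩ - vecCoord φ ⟨q, w⟩ :=
  (mfderiv (𝓡 n) (𝓡 n) φ q).map_sub v w

theorem vecCoord_smul (φ : OpenPartialHomeomorph M (EuclideanSpace ℝ (Fin n))) {q : M}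
    (c : ℝ) (v : TangentSpace (𝓡 n) q) : vecCoord φ ⟨q, c • v⟩ = c • vecCoord φ ⟨q, v⟩ :=
  (mfderiv (𝓡 n) (𝓡 n) φ q).map_smul c v

variable [IsManifold (𝓡 n) ∞ M]

theorem contMDiffOn_vecCoord (hφ : φ ∈ IsManifold.maximalAtlas (𝓡 n) ∞ M) :
    ContMDiffOn (𝓡 n).tangent 𝓘(ℝ, EuclideanSpace ℝ (Fin n)) ∞ (vecCoord φ)
      {v : TangentBundle (𝓡 n) M | v.proj ∈ φ.source} := by
  have h := (contMDiffOn_of_mem_maximalAtlas hφ).contMDiffOn_tangentMapWithin (m := ∞)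
    (by simp) φ.open_source.uniqueMDiffOn
  refine ((contMDiff_snd_tangentBundle_modelSpace (EuclideanSpace ℝ (Fin n)) (𝓡 n)).comp_contMDiffOn
    h).congr fun v hv => ?_
  simp only [Function.comp, tangentMapWithin]
  rw [mfderivWithin_of_isOpen φ.open_source hv]
  rfl

theorem contMDiffOn_mfderiv_symm (hφ : φ ∈ IsManifold.maximalAtlas (𝓡 n) ∞ M) :
    ContMDiffOn 𝓘(ℝ, EuclideanSpace ℝ (Fin n) × EuclideanSpace ℝ (Fin n)) (𝓡 n).tangent ∞
      (fun z => (⟨φ.symm z.1, mfderiv (𝓡 n) (𝓡 n) φ.symm z.1 z.2⟩ : TangentBundle (𝓡 n) M))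
      (φ.target ×ˢ univ) := by
  have h := (contMDiffOn_symm_of_mem_maximalAtlas hφ).contMDiffOn_tangentMapWithin (m := ∞)
    (by simp) φ.open_target.uniqueMDiffOn
  have h2 := contMDiff_tangentBundle_mk (EuclideanSpace ℝ (Fin n))
  refine (h.comp h2.contMDiffOn (s := φ.target ×ˢ univ) fun z hz => hz.1).congr fun z hz => ?_
  simp only [Function.comp, tangentMapWithin]
  rw [mfderivWithin_of_isOpen φ.open_target hz.1]

theorem contDiffAt_localF {F : TangentBundle (𝓡 n) M → ℝ} (hF : IsFinslerMetric F)
    (hφ : φ ∈ IsManifold.maximalAtlas (𝓡 n) ∞ M) {x y : EuclideanSpace ℝ (Fin n)}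
    (hx : x ∈ φ.target) (hy : y ≠ 0) :
    ContDiffAt ℝ ∞ (fun z : EuclideanSpace ℝ (Fin n) × EuclideanSpace ℝ (Fin n) =>
      localF F φ z.1 z.2) (x, y) := by
  have h : ContMDiffOn 𝓘(ℝ, EuclideanSpace ℝ (Fin n) × EuclideanSpace ℝ (Fin n)) 𝓘(ℝ, ℝ) ∞
      (fun z : EuclideanSpace ℝ (Fin n) × EuclideanSpace ℝ (Fin n) => localF F φ z.1 z.2)
      (φ.target ×ˢ {0}ᶜ) := by
    refine hF.smooth.comp ((contMDiffOn_mfderiv_symm hφ).mono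
      (prod_mono_right (subset_univ _))) fun z hz h0 => hz.2 ?_
    exact (chartSymmEquiv hφ hz.1).map_eq_zero_iff.1 h0
  exact (contMDiffOn_iff_contDiffOn.1 h).contDiffAt
    ((φ.open_target.prod isOpen_compl_singleton).mem_nhds ⟨hx, hy⟩)

/-- In the chart at `q`, the fibre function is `localF` at a fixed base point composed with a linear
isomorphism. -/
theorem contDiffAt_fiberFun {F : TangentBundle (𝓡 n) M → ℝ} (hF : IsFinslerMetric F) (q : M)
    {y : EuclideanSpace ℝ (Fin n)} (hy : y ≠ 0) : ContDiffAt ℝ ∞ (fiberFun F q) y := by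
  have hφ := IsManifold.chart_mem_maximalAtlas (I := 𝓡 n) (n := ∞) q
  have hq := mem_chart_target (EuclideanSpace ℝ (Fin n)) q
  set L := chartSymmEquiv hφ hq
  have h1 : fiberFun F q = (fun z : EuclideanSpace ℝ (Fin n) × EuclideanSpace ℝ (Fin n) =>
      localF F (chartAt (EuclideanSpace ℝ (Fin n)) q) z.1 z.2) ∘
      fun y => (chartAt (EuclideanSpace ℝ (Fin n)) q q, L.symm y) := by
    ext y
    rw [Function.comp_apply, localF_eq_fiberFun hφ F hq, L.apply_symm_apply,
      OpenPartialHomeomorph.left_inv _ (mem_chart_source _ q)]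
  rw [h1]
  refine ContDiffAt.comp _ (contDiffAt_localF hF hφ hq (by simpa using hy)) ?_
  exact contDiffAt_const.prodMk L.symm.contDiff.contDiffAt

theorem contMDiffOn_coordField (hφ : φ ∈ IsManifold.maximalAtlas (𝓡 n) ∞ M) (i : Fin n) :
    ContMDiffOn (𝓡 n) (𝓡 n).tangent ∞
      (fun q => (⟨q, coordField φ i q⟩ : TangentBundle (𝓡 n) M)) φ.source := by
  intro q hq
  have hV : ContMDiffAt (𝓡 n) (𝓡 n).tangent ∞ (fun x : EuclideanSpace ℝ (Fin n) =>
      (⟨x, stdVec n i⟩ : TangentBundle (𝓡 n) (EuclideanSpace ℝ (Fin n)))) (φ q) :=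
    (contMDiff_tangentBundle_mk (EuclideanSpace ℝ (Fin n))).contMDiffAt.comp (φ q)
      (contDiff_id.prodMk contDiff_const).contMDiff.contMDiffAt
  exact (ContMDiffAt.mpullback_vectorField_preimage hV
    ((contMDiffOn_of_mem_maximalAtlas hφ).contMDiffAt (φ.open_source.mem_nhds hq))
    (isInvertible_mfderiv_chart hφ hq) (by simp)).contMDiffWithinAt

end Charts

/-! ### Christoffel symbols of the connection and its torsion. -/

theorem mlieBracket_const_const {E : Type*} [NormedAddCommGroup E] [NormedSpace ℝ E] (a b x : E) :
    VectorField.mlieBracket 𝓘(ℝ, E) (fun _ : E => a) (fun _ => b) x = 0 := by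
  have h := congrFun (VectorField.mlieBracketWithin_eq_lieBracketWithin (𝕜 := ℝ)
    (V := fun _ : E => a) (W := fun _ : E => b) (s := univ)) x
  refine (congrFun VectorField.mlieBracketWithin_univ.symm x).trans (h.trans ?_)
  simp [VectorField.lieBracketWithin]
  rfl

section Connection

variable {n : ℕ} {M : Type*} [TopologicalSpace M] [ChartedSpace (EuclideanSpace ℝ (Fin n)) M]
  [IsManifold (𝓡 n) ∞ M] {φ : OpenPartialHomeomorph M (EuclideanSpace ℝ (Fin n))}
  (cov : CovariantDerivative (𝓡 n) (EuclideanSpace ℝ (Fin n)) (TangentSpace (𝓡 n) : M → Type _))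

/-- Smoothness of the connection concerns global sections, while coordinate fields are smooth only
on the chart domain. A bump function equal to `1` near `q` extends the differentiated field, and
locality of the covariant derivative removes the cutoff. -/
theorem contMDiffAt_cov_coordField [T2Space M] [cov.ContMDiffCovariantDerivative ∞]
    (hφ : φ ∈ IsManifold.maximalAtlas (𝓡 n) ∞ M) {q : M} (hq : q ∈ φ.source) (i j : Fin n) :
    ContMDiffAt (𝓡 n) (𝓡 n).tangent ∞
      (fun x => (⟨x, cov (coordField φ j) x (coordField φ i x)⟩ : TangentBundle (𝓡 n) M)) q := by
  obtain ⟨f, -, hf⟩ := (SmoothBumpFunction.nhds_basis_tsupport (I := 𝓡 n) q).mem_iff.1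
    (φ.open_source.mem_nhds hq)
  set σ : (x : M) → TangentSpace (𝓡 n) x := fun x => f x • coordField φ j x with hσ
  have hσs : ContMDiff (𝓡 n) (𝓡 n).tangent ∞ (fun x => (⟨x, σ x⟩ : TangentBundle (𝓡 n) M)) :=
    ContMDiffOn.smul_section_of_tsupport f.contMDiff.contMDiffOn φ.open_source hf
      (contMDiffOn_coordField hφ j)
  have hcov := (CovariantDerivative.ContMDiffCovariantDerivative.contMDiff (cov := cov)
    (k := ∞)).contMDiff (σ := σ) (by simpa using hσs.contMDiffOn)
  have hci : ContMDiffAt (𝓡 n) (𝓡 n).tangent ∞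
      (fun q => (⟨q, coordField φ i q⟩ : TangentBundle (𝓡 n) M)) q :=
    (contMDiffOn_coordField hφ i).contMDiffAt (φ.open_source.mem_nhds hq)
  have h1 := ContMDiffAt.clm_bundle_apply (hcov.contMDiffAt univ_mem) hci
  refine h1.congr_of_eventuallyEq ?_
  filter_upwards [f.eventuallyEq_one.eventually_nhds, φ.open_source.mem_nhds hq] with x hx hxs
  have h2 : cov (coordField φ j) x = cov σ x := by
    refine IsCovariantDerivativeOn.congr_of_eventuallyEq cov.isCovariantDerivativeOnUniv
      (((contMDiffOn_coordField hφ j).contMDiffAt (φ.open_source.mem_nhds hxs)).mdifferentiableAt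
        (by simp)) (hσs.contMDiffAt.mdifferentiableAt (by simp)) univ_mem ?_
    filter_upwards [hx] with z hz
    simp [hσ, hz]
  rw [h2]

theorem continuousOn_vecCoord_cov [T2Space M] [cov.ContMDiffCovariantDerivative ∞]
    (hφ : φ ∈ IsManifold.maximalAtlas (𝓡 n) ∞ M) (i j : Fin n) :
    ContinuousOn (fun x => vecCoord φ ⟨x, cov (coordField φ j) x (coordField φ i x)⟩) φ.source := by
  intro q hq
  have h1 := (contMDiffAt_cov_coordField cov hφ hq i j).continuousAt
  have h2 : ContinuousAt (vecCoord φ)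
      (⟨q, cov (coordField φ j) q (coordField φ i q)⟩ : TangentBundle (𝓡 n) M) :=
    (contMDiffOn_vecCoord hφ).continuousOn.continuousAt
      ((φ.open_source.preimage (FiberBundle.continuous_proj _ _)).mem_nhds hq)
  exact (ContinuousAt.comp (f := fun x => (⟨x, cov (coordField φ j) x (coordField φ i x)⟩ :
    TangentBundle (𝓡 n) M)) h2 h1).continuousWithinAt

/-- The Christoffel symbols in the chart `φ`, as a bilinear map of the coordinates. -/
def christoffelMap (φ : OpenPartialHomeomorph M (EuclideanSpace ℝ (Fin n)))
    (x : EuclideanSpace ℝ (Fin n)) :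
    EuclideanSpace ℝ (Fin n) →L[ℝ] EuclideanSpace ℝ (Fin n) →L[ℝ] EuclideanSpace ℝ (Fin n) :=
  ∑ i, ∑ j, (EuclideanSpace.proj i : EuclideanSpace ℝ (Fin n) →L[ℝ] ℝ).smulRight
    ((EuclideanSpace.proj j : EuclideanSpace ℝ (Fin n) →L[ℝ] ℝ).smulRight
      (vecCoord φ ⟨φ.symm x, cov (coordField φ j) (φ.symm x) (coordField φ i (φ.symm x))⟩))

theorem christoffelMap_apply (x a y : EuclideanSpace ℝ (Fin n)) (k : Fin n) :
    christoffelMap cov φ x a y k = ∑ i, ∑ j, connSymbol cov φ k i j (φ.symm x) * a i * y j := by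
  simp only [christoffelMap, connSymbol, sum_apply,
    ContinuousLinearMap.smulRight_apply, smul_apply, WithLp.ofLp_sum,
    Finset.sum_apply, PiLp.smul_apply, smul_eq_mul, PiLp.proj_apply]
  refine Finset.sum_congr rfl fun i _ => Finset.sum_congr rfl fun j _ => by ring

theorem continuousOn_christoffelMap [T2Space M] [cov.ContMDiffCovariantDerivative ∞]
    (hφ : φ ∈ IsManifold.maximalAtlas (𝓡 n) ∞ M) :
    ContinuousOn (christoffelMap cov φ) φ.target := by
  have : ContinuousAdd (EuclideanSpace ℝ (Fin n) →L[ℝ] EuclideanSpace ℝ (Fin n) →L[ℝ]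
      EuclideanSpace ℝ (Fin n)) := ContinuousLinearMap.topologicalAddGroup.toContinuousAdd
  refine continuousOn_finsetSum _ fun i _ => continuousOn_finsetSum _ fun j _ => ?_
  refine (ContinuousLinearMap.smulRightL ℝ _ _ _).continuous.comp_continuousOn
    ((ContinuousLinearMap.smulRightL ℝ _ _ _).continuous.comp_continuousOn ?_)
  exact (continuousOn_vecCoord_cov cov hφ i j).comp φ.continuousOn_symm φ.mapsTo_symm

/-- Coordinate fields are pullbacks of constant fields, and pullback commutes with the bracket. -/
theorem mlieBracket_coordField (hφ : φ ∈ IsManifold.maximalAtlas (𝓡 n) ∞ M) {q : M}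
    (hq : q ∈ φ.source) (i j : Fin n) :
    VectorField.mlieBracket (𝓡 n) (coordField φ i) (coordField φ j) q = 0 := by
  have hV : ∀ i, MDifferentiableAt (𝓡 n) (𝓡 n).tangent (fun x : EuclideanSpace ℝ (Fin n) =>
      (⟨x, stdVec n i⟩ : TangentBundle (𝓡 n) (EuclideanSpace ℝ (Fin n)))) (φ q) := fun i =>
    ((contMDiff_tangentBundle_mk (EuclideanSpace ℝ (Fin n))).contMDiffAt.comp (φ q)
      (contDiff_id.prodMk contDiff_const).contMDiff.contMDiffAt).mdifferentiableAt (by simp)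
  have : IsManifold (𝓡 n) (minSmoothness ℝ 2) M := by simp; infer_instance
  have h := VectorField.mpullback_mlieBracket (n := ∞) (hV i) (hV j)
    ((contMDiffOn_of_mem_maximalAtlas hφ).contMDiffAt (φ.open_source.mem_nhds hq))
    (by simpa using two_le_infty)
  unfold coordField
  refine h.symm.trans ?_
  rw [VectorField.mpullback_apply]
  refine (congrArg _ (mlieBracket_const_const _ _ _)).trans ?_
  simp

/-- Since coordinate fields commute, their torsion is just the antisymmetric part of the symbols. -/
theorem connSymbol_sub_swap (hφ : φ ∈ IsManifold.maximalAtlas (𝓡 n) ∞ M) {q : M}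
    (hq : q ∈ φ.source) {ρ : (x : M) → TangentSpace (𝓡 n) x →L[ℝ] ℝ}
    (hρ : HasSemiSymmetricTorsion cov ρ) (k i j : Fin n) :
    connSymbol cov φ k i j q - connSymbol cov φ k j i q =
      ρ q (coordField φ j q) * (if k = i then 1 else 0)
        - ρ q (coordField φ i q) * (if k = j then 1 else 0) := by
  have hd : ∀ i, MDifferentiableAt (𝓡 n) (𝓡 n).tangent
      (fun q => (⟨q, coordField φ i q⟩ : TangentBundle (𝓡 n) M)) q := fun i =>
    ((contMDiffOn_coordField hφ i).contMDiffAt (φ.open_source.mem_nhds hq)).mdifferentiableAt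
      (by simp)
  have h1 := cov.torsion_apply (hd i) (hd j)
  rw [hρ, mlieBracket_coordField hφ hq, sub_zero] at h1
  have h3 := congrArg (fun v : TangentSpace (𝓡 n) q => vecCoord φ ⟨q, v⟩) h1
  simp only [vecCoord_sub, vecCoord_smul, vecCoord_coordField hφ hq] at h3
  have h4 := congrArg (fun v : EuclideanSpace ℝ (Fin n) => v k) h3
  simp only [stdVec] at h4
  simpa [connSymbol, Pi.single_apply] using h4.symm

end Connection

/-! ### Parallel transport along coordinate rays. -/

section Transport

variable {n : ℕ} {M : Type*} [TopologicalSpace M]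
  [ChartedSpace (EuclideanSpace ℝ (Fin n)) M] [IsManifold (𝓡 n) ∞ M]
  {φ : OpenPartialHomeomorph M (EuclideanSpace ℝ (Fin n))}
  {cov : CovariantDerivative (𝓡 n) (EuclideanSpace ℝ (Fin n)) (TangentSpace (𝓡 n) : M → Type _)}

/-- The vector field with coordinates `B t y` along a coordinate line is parallel if `B` solves the
matrix form of the equation of parallel transport. -/
theorem isParallelOn_line (hφ : φ ∈ IsManifold.maximalAtlas (𝓡 n) ∞ M)
    {x₀ a : EuclideanSpace ℝ (Fin n)}
    {B : ℝ → EuclideanSpace ℝ (Fin n) →L[ℝ] EuclideanSpace ℝ (Fin n)} {s : Set ℝ} (hs : IsOpen s)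
    (hB : ∀ t ∈ s, x₀ + t • a ∈ φ.target ∧
      HasDerivAt B (-(christoffelMap cov φ (x₀ + t • a) a * B t)) t)
    (y : EuclideanSpace ℝ (Fin n)) :
    IsParallelOn cov (fun t => (⟨φ.symm (x₀ + t • a),
      mfderiv (𝓡 n) (𝓡 n) φ.symm (x₀ + t • a) (B t y)⟩ : TangentBundle (𝓡 n) M)) s := by
  intro t ht
  refine ⟨φ, hφ, φ.mapsTo_symm (hB t ht).1, fun k => ?_⟩
  have hcoord : ∀ τ ∈ s, vecCoord φ ⟨φ.symm (x₀ + τ • a),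
      mfderiv (𝓡 n) (𝓡 n) φ.symm (x₀ + τ • a) (B τ y)⟩ = B τ y := fun τ hτ =>
    vecCoord_mfderiv_symm hφ (hB τ hτ).1 _
  have hbase : ∀ i, deriv (fun τ => φ (φ.symm (x₀ + τ • a)) i) t = a i := fun i => by
    have h1 : (fun τ => φ (φ.symm (x₀ + τ • a)) i) =ᶠ[𝓝 t] fun τ => x₀ i + τ * a i := by
      filter_upwards [hs.mem_nhds ht] with τ hτ
      rw [φ.right_inv (hB τ hτ).1]
      rfl
    rw [h1.deriv_eq]
    simp
  have hd : HasDerivAt (fun τ => B τ y k) ((-(christoffelMap cov φ (x₀ + t • a) a * B t)) y k) t :=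
    (EuclideanSpace.proj k : EuclideanSpace ℝ (Fin n) →L[ℝ] ℝ).hasFDerivAt.comp_hasDerivAt t
      ((ContinuousLinearMap.apply ℝ (EuclideanSpace ℝ (Fin n)) y).hasFDerivAt.comp_hasDerivAt t (hB t ht).2)
  have hval : (-(christoffelMap cov φ (x₀ + t • a) a * B t)) y k =
      -∑ i, ∑ j, connSymbol cov φ k i j (φ.symm (x₀ + t • a)) * a i * B t y j := by
    rw [← christoffelMap_apply]
    rfl
  simp only [hbase]
  rw [hcoord t ht, ← hval]
  refine hd.congr_of_eventuallyEq ?_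
  filter_upwards [hs.mem_nhds ht] with τ hτ
  rw [hcoord τ hτ]

/-- Parallel transport along coordinate rays gives linear isometries of the fibres whose matrix is
differentiable at the centre, the derivative being given by the Christoffel symbols. -/
theorem exists_isometric_transport [T2Space M] [cov.ContMDiffCovariantDerivative ∞]
    {F : TangentBundle (𝓡 n) M → ℝ} (hcompat : IsCompatible F cov)
    (hφ : φ ∈ IsManifold.maximalAtlas (𝓡 n) ∞ M) {x₀ : EuclideanSpace ℝ (Fin n)}
    (hx₀ : x₀ ∈ φ.target) :
    ∃ A : EuclideanSpace ℝ (Fin n) → EuclideanSpace ℝ (Fin n) →L[ℝ] EuclideanSpace ℝ (Fin n),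
      A x₀ = 1 ∧ HasFDerivAt A (-christoffelMap cov φ x₀) x₀ ∧
      ∀ᶠ x in 𝓝 x₀, x ∈ φ.target ∧ IsUnit (A x) ∧
        ∀ y, localF F φ x (A x y) = localF F φ x₀ y := by
  obtain ⟨A, hA0, hA, hAx⟩ := exists_radial_transport (φ.open_target.mem_nhds hx₀)
    (continuousOn_christoffelMap cov hφ)
  have hunit : ∀ᶠ x in 𝓝 x₀, IsUnit (A x) :=
    hA.continuousAt.eventually (Units.isOpen.mem_nhds (by rw [hA0]; exact isUnit_one))
  refine ⟨A, hA0, hA, ?_⟩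
  filter_upwards [hAx, hunit, φ.open_target.mem_nhds hx₀] with x ⟨B, hB0, hB1, hB⟩ hxu hx
  refine ⟨hx, hxu, fun y => ?_⟩
  have hsmooth : ContMDiffOn 𝓘(ℝ, ℝ) (𝓡 n) ∞ (fun t : ℝ => φ.symm (x₀ + t • (x - x₀)))
      (Ioo (-2) 2) := by
    refine (contMDiffOn_symm_of_mem_maximalAtlas hφ).comp ?_ fun t ht => (hB t ht).1
    exact (contDiff_const.add (contDiff_id.smul contDiff_const)).contMDiff.contMDiffOn
  -- Compatibility compares time `1`, where the ray is at `x` and `B` is `A x`, with time `0`, where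
  -- it is at `x₀` and `B` is the identity.
  have h := hcompat _ (-2) 2 hsmooth (isParallelOn_line hφ isOpen_Ioo hB y)
    1 (by norm_num) 0 (by norm_num)
  change localF F φ (x₀ + (1 : ℝ) • (x - x₀)) (B 1 y)
    = localF F φ (x₀ + (0 : ℝ) • (x - x₀)) (B 0 y) at h
  simp only [one_smul, zero_smul, add_zero, add_sub_cancel, hB1, hB0] at h
  exact h

end Transport

/-! ### Naturality of the averaged metric under fibre isometries. -/

section AveragedMetric

variable {n : ℕ} {M : Type*} [TopologicalSpace M] [ChartedSpace (EuclideanSpace ℝ (Fin n)) M]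
  {F : TangentBundle (𝓡 n) M → ℝ} {p q : M}
  (L : EuclideanSpace ℝ (Fin n) ≃L[ℝ] EuclideanSpace ℝ (Fin n))

theorem vertHess_map (hL : ∀ y, fiberFun F q (L y) = fiberFun F p y)
    (y v w : EuclideanSpace ℝ (Fin n)) : vertHess F q (L y) (L v) (L w) = vertHess F p y v w := by
  have h1 : (fun y => fiberFun F p y ^ 2 / 2) = (fun y => fiberFun F q y ^ 2 / 2) ∘ L := by
    ext y; simp [hL]
  have h2 : (fun y' => fderiv ℝ (fun y'' => fiberFun F p y'' ^ 2 / 2) y' w) =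
      (fun z => fderiv ℝ (fun y'' => fiberFun F q y'' ^ 2 / 2) z (L w)) ∘ L := by
    ext y'
    rw [h1, L.comp_right_fderiv]
    rfl
  rw [vertHess, vertHess, h2, L.comp_right_fderiv]
  rfl

/-- The `√det g`-volume on the Finslerian unit ball at `p`. -/
def ballMeasure (F : TangentBundle (𝓡 n) M → ℝ) (p : M) : Measure (EuclideanSpace ℝ (Fin n)) :=
  (volume.restrict {y | fiberFun F p y ≤ 1}).withDensity fun y => ENNReal.ofReal (sqrtDet F p y)

theorem ballMeasure_singleton_zero (hn : 2 ≤ n) (F : TangentBundle (𝓡 n) M → ℝ) (p : M) :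
    ballMeasure F p {0} = 0 := by
  have : Nonempty (Fin n) := ⟨⟨0, by omega⟩⟩
  refine withDensity_absolutelyContinuous _ _ (Measure.restrict_le_self.absolutelyContinuous ?_)
  exact measure_singleton 0

theorem measurable_vertHess (F : TangentBundle (𝓡 n) M → ℝ) (p : M)
    (v w : EuclideanSpace ℝ (Fin n)) : Measurable fun y => vertHess F p y v w :=
  measurable_fderiv_apply_const ℝ _ v

theorem averagedMetric_def (F : TangentBundle (𝓡 n) M → ℝ) (p : M)
    (v w : EuclideanSpace ℝ (Fin n)) :
    averagedMetric F p v w = ∫ y, vertHess F p y v w ∂(indicatrixMeasure F p) := rfl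

variable [IsManifold (𝓡 n) ∞ M]

theorem contDiffAt_energy (hF : IsFinslerMetric F) {y : EuclideanSpace ℝ (Fin n)} (hy : y ≠ 0) :
    ContDiffAt ℝ ∞ (fun y => fiberFun F p y ^ 2 / 2) y :=
  ((contDiffAt_fiberFun hF p hy).pow 2).div_const 2

/-- Away from the origin the iterated directional derivative is the second Fréchet derivative, which
supplies bilinearity. -/
theorem vertHess_eq (hF : IsFinslerMetric F) {y : EuclideanSpace ℝ (Fin n)} (hy : y ≠ 0)
    (v w : EuclideanSpace ℝ (Fin n)) :
    vertHess F p y v w = fderiv ℝ (fderiv ℝ fun y => fiberFun F p y ^ 2 / 2) y v w := by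
  have h1 : DifferentiableAt ℝ (fderiv ℝ fun y => fiberFun F p y ^ 2 / 2) y :=
    ((contDiffAt_energy hF hy).fderiv_right (m := 1)
      (by rw [one_add_one_eq_two]; exact two_le_infty)).differentiableAt (by simp)
  rw [vertHess, fderiv_clm_apply h1 (differentiableAt_const w)]
  simp

theorem vertHess_symm (hF : IsFinslerMetric F) {y : EuclideanSpace ℝ (Fin n)} (hy : y ≠ 0)
    (v w : EuclideanSpace ℝ (Fin n)) : vertHess F p y v w = vertHess F p y w v := by
  rw [vertHess_eq hF hy, vertHess_eq hF hy]
  exact ((contDiffAt_energy hF hy).isSymmSndFDerivAt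
    (by simpa using two_le_infty)) v w

/-- Positivity on `v + w` and `v - w` bounds the mixed term. It dominates off-diagonal integrands by
diagonal ones in `averagedMetric_of_orthonormal`. -/
theorem abs_vertHess_le (hF : IsFinslerMetric F) {y : EuclideanSpace ℝ (Fin n)} (hy : y ≠ 0)
    (v w : EuclideanSpace ℝ (Fin n)) :
    |vertHess F p y v w| ≤ vertHess F p y v v + vertHess F p y w w := by
  have hpos : ∀ u, 0 ≤ vertHess F p y u u := fun u => by
    rcases eq_or_ne u 0 with rfl | hu
    · rw [vertHess_eq hF hy]; simp
    · exact (hF.convex p y u hy hu).le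
  have hs := vertHess_symm (p := p) hF hy v w
  have h1 := hpos (v + w)
  have h2 := hpos (v - w)
  have h3 := hpos v
  have h4 := hpos w
  simp only [vertHess_eq hF hy, map_add, map_sub, add_apply, sub_apply] at h1 h2 h3 h4 hs ⊢
  rw [abs_le]
  constructor <;> linarith

theorem continuous_fiberFun (hF : IsFinslerMetric F) (p : M) : Continuous (fiberFun F p) :=
  hF.continuous.comp (FiberBundle.continuous_totalSpaceMk (EuclideanSpace ℝ (Fin n))
    (TangentSpace (𝓡 n) : M → Type _) p)

theorem fiberFun_ne_zero (hF : IsFinslerMetric F) (p : M) {y : EuclideanSpace ℝ (Fin n)}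
    (hy : y ≠ 0) : fiberFun F p y ≠ 0 := fun h => hy ((hF.definite p y).1 h)

/-- The Gram matrices are congruent through the matrix of `L`. The resulting `|det L|` is the
Jacobian in the change of variables of `map_ballMeasure`. -/
theorem sqrtDet_map (hF : IsFinslerMetric F) (hL : ∀ y, fiberFun F q (L y) = fiberFun F p y)
    {y : EuclideanSpace ℝ (Fin n)} (hy : y ≠ 0) :
    sqrtDet F p y = |(L : EuclideanSpace ℝ (Fin n) →L[ℝ] EuclideanSpace ℝ (Fin n)).det|
      * sqrtDet F q (L y) := by
  set b := EuclideanSpace.basisFun (Fin n) ℝ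
  set P : Matrix (Fin n) (Fin n) ℝ := LinearMap.toMatrix b.toBasis b.toBasis
    (L : EuclideanSpace ℝ (Fin n) →L[ℝ] EuclideanSpace ℝ (Fin n)).toLinearMap with hP
  have hPdet : P.det = (L : EuclideanSpace ℝ (Fin n) →L[ℝ] EuclideanSpace ℝ (Fin n)).det :=
    LinearMap.det_toMatrix _ _
  have hLy : L y ≠ 0 := by simpa using hy
  have hcol : ∀ i, L (stdVec n i) = ∑ a, P a i • stdVec n a := fun i => by
    have := b.toBasis.sum_repr (L (stdVec n i))
    rw [← this]
    refine Finset.sum_congr rfl fun a _ => ?_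
    simp [hP, LinearMap.toMatrix_apply, b, stdVec]
  have hmat : (Matrix.of fun i j => vertHess F p y (stdVec n i) (stdVec n j)) =
      P.transpose * (Matrix.of fun i j => vertHess F q (L y) (stdVec n i) (stdVec n j)) * P := by
    ext i j
    rw [Matrix.of_apply, ← vertHess_map L hL, hcol, hcol, vertHess_eq hF hLy]
    simp only [map_sum, map_smul, sum_apply, smul_apply, smul_eq_mul, Matrix.mul_apply,
      Matrix.transpose_apply, Matrix.of_apply, vertHess_eq hF hLy, Finset.sum_mul, Finset.mul_sum]
    refine Finset.sum_congr rfl fun a _ => Finset.sum_congr rfl fun c _ => by ring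
  rw [sqrtDet, sqrtDet, hmat, Matrix.det_mul, Matrix.det_mul, Matrix.det_transpose, hPdet,
    mul_right_comm, Real.sqrt_mul (mul_self_nonneg _), Real.sqrt_mul_self_eq_abs]

theorem map_ballMeasure (hn : 2 ≤ n) (hF : IsFinslerMetric F)
    (hL : ∀ y, fiberFun F q (L y) = fiberFun F p y) :
    (ballMeasure F p).map L = ballMeasure F q := by
  have : Nonempty (Fin n) := ⟨⟨0, by omega⟩⟩
  ext s hs
  have hLm : Measurable L := L.continuous.measurable
  have hball : ∀ r, MeasurableSet {y | fiberFun F r y ≤ 1} := fun r =>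
    (isClosed_le (continuous_fiberFun hF r) continuous_const).measurableSet
  rw [Measure.map_apply hLm hs, ballMeasure, ballMeasure, withDensity_apply _ (hLm hs),
    withDensity_apply _ hs, Measure.restrict_restrict hs, Measure.restrict_restrict (hLm hs)]
  have himg : s ∩ {y | fiberFun F q y ≤ 1} = L '' (L ⁻¹' s ∩ {y | fiberFun F p y ≤ 1}) := by
    ext z
    constructor
    · rintro ⟨h1, h2⟩
      refine ⟨L.symm z, ⟨by simpa using h1, ?_⟩, by simp⟩
      rw [mem_ofPred_eq, ← hL, L.apply_symm_apply]
      exact h2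
    · rintro ⟨y, ⟨h1, h2⟩, rfl⟩
      exact ⟨h1, by rw [mem_ofPred_eq, hL]; exact h2⟩
  rw [himg, lintegral_image_eq_lintegral_abs_det_fderiv_mul volume ((hLm hs).inter (hball p))
    (fun x _ => L.hasFDerivAt.hasFDerivWithinAt) L.injective.injOn]
  refine lintegral_congr_ae (ae_restrict_of_ae ?_)
  filter_upwards [(measure_singleton (0 : EuclideanSpace ℝ (Fin n)) :
    volume {(0 : EuclideanSpace ℝ (Fin n))} = 0) |> compl_mem_ae_iff.2] with y hy
  rw [sqrtDet_map L hF hL hy, ENNReal.ofReal_mul (abs_nonneg _)]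

theorem measurable_radial (hF : IsFinslerMetric F) (p : M) :
    Measurable fun y => (fiberFun F p y)⁻¹ • y :=
  (continuous_fiberFun hF p).measurable.inv.smul measurable_id

/-- A linear isometry commutes with the radial projection onto the indicatrix, so the claim reduces
to the ball measures. -/
theorem map_indicatrixMeasure (hn : 2 ≤ n) (hF : IsFinslerMetric F)
    (hL : ∀ y, fiberFun F q (L y) = fiberFun F p y) :
    (indicatrixMeasure F p).map L = indicatrixMeasure F q := by
  have hLm : Measurable L := L.continuous.measurable
  change (n • (ballMeasure F p).map _).map L = n • (ballMeasure F q).map _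
  rw [← map_ballMeasure L hn hF hL, Measure.map_map (measurable_radial hF q) hLm,
    ← Nat.cast_smul_eq_nsmul ENNReal, ← Nat.cast_smul_eq_nsmul ENNReal, Measure.map_smul,
    Measure.map_map hLm (measurable_radial hF p)]
  congr 2
  ext1 y
  simp [hL]

/-- The averaged Riemannian metric is natural with respect to linear isometries of the fibres. -/
theorem averagedMetric_map (hn : 2 ≤ n) (hF : IsFinslerMetric F)
    (hL : ∀ y, fiberFun F q (L y) = fiberFun F p y) (v w : EuclideanSpace ℝ (Fin n)) :
    averagedMetric F q (L v) (L w) = averagedMetric F p v w := by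
  have h := L.toHomeomorph.measurableEmbedding.integral_map (μ := indicatrixMeasure F p)
    (fun y => vertHess F q y (L v) (L w))
  rw [averagedMetric_def, averagedMetric_def, ← map_indicatrixMeasure L hn hF hL]
  refine h.trans (integral_congr_ae (Eventually.of_forall fun y => ?_))
  exact vertHess_map L hL y v w

/-- Only the origin projects radially to the origin, and it is a null set. This lets pointwise facts
about the Hessian, valid off the origin, pass under the integral. -/
theorem ae_indicatrixMeasure_ne_zero (hn : 2 ≤ n) (hF : IsFinslerMetric F) (p : M) :
    ∀ᵐ y ∂(indicatrixMeasure F p), y ≠ 0 := by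
  have h : (fun y => (fiberFun F p y)⁻¹ • y) ⁻¹' {0} = {0} := by
    ext y
    by_cases hy : y = 0
    · simp [hy]
    · simp [hy, fiberFun_ne_zero hF p hy]
  have h0 : indicatrixMeasure F p {0} = 0 := by
    change (n • (ballMeasure F p).map _) {0} = 0
    rw [Measure.smul_apply, Measure.map_apply (measurable_radial hF p) (measurableSet_singleton 0),
      h, ballMeasure_singleton_zero hn, smul_zero]
  exact compl_mem_ae_iff.2 h0

theorem sum_smul_stdVec (a : EuclideanSpace ℝ (Fin n)) : ∑ i, a i • stdVec n i = a := by
  simpa [stdVec] using (EuclideanSpace.basisFun (Fin n) ℝ).sum_repr a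

/-- The averaged metric at `p` is determined by its matrix in a basis that is orthonormal for it. -/
theorem averagedMetric_of_orthonormal (hn : 2 ≤ n) (hF : IsFinslerMetric F)
    (D : EuclideanSpace ℝ (Fin n) →L[ℝ] EuclideanSpace ℝ (Fin n))
    (hD : ∀ i j, averagedMetric F p (D (stdVec n i)) (D (stdVec n j)) = if i = j then 1 else 0)
    (a b : EuclideanSpace ℝ (Fin n)) : averagedMetric F p (D a) (D b) = ∑ i, a i * b i := by
  set e : Fin n → EuclideanSpace ℝ (Fin n) := fun i => D (stdVec n i) with he
  have hsum : ∀ a, D a = ∑ i, a i • e i := fun a => by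
    conv_lhs => rw [← sum_smul_stdVec a]
    simp [he]
  have hdiag : ∀ i, Integrable (fun y => vertHess F p y (e i) (e i)) (indicatrixMeasure F p) := by
    intro i
    -- A non-integrable function has integral `0` by convention, against the diagonal value `1`.
    by_contra h
    have h1 := hD i i
    rw [averagedMetric_def, integral_undef h] at h1
    simp at h1
  have hne := ae_indicatrixMeasure_ne_zero hn hF p
  have hint : ∀ i j, Integrable (fun y => vertHess F p y (e i) (e j)) (indicatrixMeasure F p) := by
    intro i j
    refine ((hdiag i).add (hdiag j)).mono' (measurable_vertHess F p _ _).aestronglyMeasurable ?_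
    filter_upwards [hne] with y hy using abs_vertHess_le hF hy _ _
  have hexp : averagedMetric F p (D a) (D b) =
      ∫ y, ∑ i, ∑ j, a i * b j * vertHess F p y (e i) (e j) ∂(indicatrixMeasure F p) := by
    rw [averagedMetric_def]
    refine integral_congr_ae ?_
    filter_upwards [hne] with y hy
    simp only [vertHess_eq hF hy, hsum, map_sum, map_smul, sum_apply, smul_apply, smul_eq_mul,
      Finset.mul_sum]
    refine Finset.sum_comm.trans ?_
    refine Finset.sum_congr rfl fun i _ => Finset.sum_congr rfl fun j _ => by ring
  rw [hexp, integral_finsetSum _ fun i _ => integrable_finsetSum _ fun j _ =>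
    (hint i j).const_mul _]
  refine Finset.sum_congr rfl fun i _ => ?_
  rw [integral_finsetSum _ fun j _ => (hint i j).const_mul _]
  have : ∀ j, ∫ y, a i * b j * vertHess F p y (e i) (e j) ∂(indicatrixMeasure F p) =
      a i * b j * if i = j then 1 else 0 := fun j => by
    rw [integral_const_mul, ← hD i j]
    rfl
  simp [this]

end AveragedMetric

/-! ### Algebra of the connection symbols. -/

section Symbols

variable {n : ℕ}

/-- The polarization identity in coordinates. -/
theorem eq_zero_of_quadratic_eq_zero {S : Fin n → Fin n → ℝ} (hS : ∀ i j, S i j = S j i)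
    (h : ∀ a : EuclideanSpace ℝ (Fin n), ∑ i, ∑ j, S i j * a i * a j = 0) (i j : Fin n) :
    S i j = 0 := by
  have hexp : ∀ i j, S i i + S i j + (S j i + S j j) = 0 := fun i j => by
    have := h (stdVec n i + stdVec n j)
    simp only [stdVec, PiLp.add_apply, PiLp.single_apply, mul_add, Finset.sum_add_distrib,
      mul_ite, mul_one, mul_zero, Finset.sum_ite_eq', Finset.mem_univ, if_true] at this
    linarith
  have h1 := hexp i i
  have h2 := hexp j j
  have h3 := hexp i j
  have h4 := hS i j
  linarith

/-- A connection that is metric at the centre of orthonormal normal coordinates is determined there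
by its torsion. -/
theorem symbol_eq_of_skew_of_torsion {c : Fin n → Fin n → Fin n → ℝ} {r : Fin n → ℝ}
    (hskew : ∀ k i j, c k i j + c j i k = 0)
    (htor : ∀ k i j, c k i j - c k j i =
      r j * (if k = i then 1 else 0) - r i * (if k = j then 1 else 0)) (k i j : Fin n) :
    c k i j = r j * (if k = i then 1 else 0) - r k * (if i = j then 1 else 0) := by
  -- Koszul's trick: alternating torsion and skewness through the permutations of `k, i, j` returns
  -- to `-c k i j`, which determines `2 * c k i j`.
  have h1 := htor k i j
  have h2 := htor i j k
  have h3 := htor j k i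
  have h4 := hskew k j i
  have h5 := hskew i k j
  have h6 := hskew j i k
  simp only [@eq_comm _ j k, @eq_comm _ j i, @eq_comm _ i k] at h1 h2 h3 ⊢
  linarith

end Symbols

/-! ### Compatibility and torsion at the centre of normal coordinates. -/

section NormalCoordinates

variable {n : ℕ} {M : Type*} [TopologicalSpace M]
  [ChartedSpace (EuclideanSpace ℝ (Fin n)) M]
  {φ : OpenPartialHomeomorph M (EuclideanSpace ℝ (Fin n))}
  {F : TangentBundle (𝓡 n) M → ℝ}

/-- An isometry of the fibres in coordinates, as an isometry of the tangent spaces. -/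
theorem exists_fiber_isometry (hφ : φ ∈ IsManifold.maximalAtlas (𝓡 n) ∞ M)
    {x₀ x : EuclideanSpace ℝ (Fin n)} (hx₀ : x₀ ∈ φ.target) (hx : x ∈ φ.target)
    {B : EuclideanSpace ℝ (Fin n) →L[ℝ] EuclideanSpace ℝ (Fin n)} (hB : IsUnit B)
    (h : ∀ y, localF F φ x (B y) = localF F φ x₀ y) :
    ∃ L : EuclideanSpace ℝ (Fin n) ≃L[ℝ] EuclideanSpace ℝ (Fin n),
      (∀ y, fiberFun F (φ.symm x) (L y) = fiberFun F (φ.symm x₀) y) ∧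
      ∀ y, L (chartSymmEquiv hφ hx₀ y) = chartSymmEquiv hφ hx (B y) := by
  obtain ⟨u, rfl⟩ := hB
  refine ⟨((chartSymmEquiv hφ hx₀).symm.trans (ContinuousLinearEquiv.unitsEquiv ℝ _ u)).trans
    (chartSymmEquiv hφ hx), fun y => ?_, fun y => ?_⟩
  · have := h ((chartSymmEquiv hφ hx₀).symm y)
    rw [localF_eq_fiberFun hφ F hx, localF_eq_fiberFun hφ F hx₀,
      ContinuousLinearEquiv.apply_symm_apply] at this
    exact this
  · simp

variable [IsManifold (𝓡 n) ∞ M]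
  {cov : CovariantDerivative (𝓡 n) (EuclideanSpace ℝ (Fin n)) (TangentSpace (𝓡 n) : M → Type _)}

/-- The inverse isometry carries the coordinate basis at `x` back to `x₀`, where the averaged metric
is the Euclidean product. -/
theorem metricCoeff_eq_sum (hn : 2 ≤ n) (hF : IsFinslerMetric F)
    (hφ : φ ∈ IsManifold.maximalAtlas (𝓡 n) ∞ M)
    {x₀ x : EuclideanSpace ℝ (Fin n)} (hx₀ : x₀ ∈ φ.target) (hx : x ∈ φ.target)
    (horth : ∀ i j, metricCoeff (averagedMetric F) φ i j x₀ = if i = j then 1 else 0)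
    {B : EuclideanSpace ℝ (Fin n) →L[ℝ] EuclideanSpace ℝ (Fin n)} (hB : IsUnit B)
    (h : ∀ y, localF F φ x (B y) = localF F φ x₀ y) (i j : Fin n) :
    metricCoeff (averagedMetric F) φ i j x =
      ∑ k, Ring.inverse B (stdVec n i) k * Ring.inverse B (stdVec n j) k := by
  obtain ⟨L, hL, hLB⟩ := exists_fiber_isometry hφ hx₀ hx hB h
  have hinv : ∀ y, chartSymmEquiv hφ hx y = L (chartSymmEquiv hφ hx₀ (Ring.inverse B y)) :=
    fun y => by
      rw [hLB]
      have : (B * Ring.inverse B) y = y := by rw [Ring.mul_inverse_cancel B hB]; rfl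
      exact congrArg _ this.symm
  have h1 : metricCoeff (averagedMetric F) φ i j x = averagedMetric F (φ.symm x)
    (chartSymmEquiv hφ hx (stdVec n i)) (chartSymmEquiv hφ hx (stdVec n j)) := rfl
  rw [h1, hinv, hinv, averagedMetric_map L hn hF hL]
  exact averagedMetric_of_orthonormal hn hF
    (chartSymmEquiv hφ hx₀ : EuclideanSpace ℝ (Fin n) →L[ℝ] EuclideanSpace ℝ (Fin n)) horth _ _

theorem christoffelMap_stdVec (x y : EuclideanSpace ℝ (Fin n)) (k i : Fin n) :
    christoffelMap cov φ x (stdVec n i) y k = ∑ j, connSymbol cov φ k i j (φ.symm x) * y j := by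
  rw [christoffelMap_apply]
  simp [stdVec, Finset.sum_ite_irrel, ite_mul, mul_ite]

/-- The averaged metric is parallel. -/
theorem pderiv_metricCoeff [T2Space M] [cov.ContMDiffCovariantDerivative ∞] (hn : 2 ≤ n)
    (hF : IsFinslerMetric F) (hcompat : IsCompatible F cov)
    (hφ : φ ∈ IsManifold.maximalAtlas (𝓡 n) ∞ M)
    {x₀ : EuclideanSpace ℝ (Fin n)} (hx₀ : x₀ ∈ φ.target)
    (horth : ∀ i j, metricCoeff (averagedMetric F) φ i j x₀ = if i = j then 1 else 0)
    (l i j : Fin n) :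
    pderiv l (metricCoeff (averagedMetric F) φ i j) x₀ =
      connSymbol cov φ j l i (φ.symm x₀) + connSymbol cov φ i l j (φ.symm x₀) := by
  obtain ⟨A, hA0, hA, hAx⟩ := exists_isometric_transport (F := F) hcompat hφ hx₀
  -- Inversion has derivative `-1` at the identity, which turns `-Γ` into `Γ`.
  have hinv : HasFDerivAt (fun x => Ring.inverse (A x)) (christoffelMap cov φ x₀) x₀ := by
    have h1 := hasFDerivAt_ringInverse (𝕜 := ℝ)
      (1 : (EuclideanSpace ℝ (Fin n) →L[ℝ] EuclideanSpace ℝ (Fin n))ˣ)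
    rw [Units.val_one, ← hA0] at h1
    refine (h1.comp x₀ hA).congr_fderiv ?_
    ext a : 1
    simp
  have hcoord : ∀ i k, HasFDerivAt (fun x => Ring.inverse (A x) (stdVec n i) k)
      (((EuclideanSpace.proj k : EuclideanSpace ℝ (Fin n) →L[ℝ] ℝ).comp
        (ContinuousLinearMap.apply ℝ (EuclideanSpace ℝ (Fin n)) (stdVec n i))).comp
          (christoffelMap cov φ x₀)) x₀ := fun i k =>
    ((EuclideanSpace.proj k : EuclideanSpace ℝ (Fin n) →L[ℝ] ℝ).comp
      (ContinuousLinearMap.apply ℝ (EuclideanSpace ℝ (Fin n)) (stdVec n i))).hasFDerivAt.comp x₀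
        hinv
  have hmetric : metricCoeff (averagedMetric F) φ i j =ᶠ[𝓝 x₀] fun x =>
      ∑ k, Ring.inverse (A x) (stdVec n i) k * Ring.inverse (A x) (stdVec n j) k := by
    filter_upwards [hAx] with x hx
    exact metricCoeff_eq_sum hn hF hφ hx₀ hx.1 horth hx.2.1 hx.2.2 i j
  have hd := HasFDerivAt.fun_sum (u := Finset.univ) fun k _ => (hcoord i k).fun_mul (hcoord j k)
  rw [pderiv, hmetric.fderiv_eq, hd.fderiv, hA0]
  simp only [sum_apply, add_apply, smul_apply, ContinuousLinearMap.comp_apply,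
    ContinuousLinearMap.apply_apply, PiLp.proj_apply, christoffelMap_stdVec, Ring.inverse_one,
    one_apply_eq_self, smul_eq_mul]
  simp [stdVec, Finset.sum_add_distrib]
  ring

/-- At the centre of normal coordinates the symbols of a metric connection are skew-symmetric. -/
theorem connSymbol_skew_of_isNormalChart [T2Space M] [cov.ContMDiffCovariantDerivative ∞]
    (hn : 2 ≤ n) (hF : IsFinslerMetric F) (hcompat : IsCompatible F cov) {p : M}
    (hφ : IsNormalChart (averagedMetric F) φ p) (k i j : Fin n) :
    connSymbol cov φ k i j p + connSymbol cov φ j i k p = 0 := by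
  have h0 : (0 : EuclideanSpace ℝ (Fin n)) ∈ φ.target := by
    rw [← hφ.center]; exact φ.mapsTo hφ.mem_source
  have hp : φ.symm 0 = p := by rw [← hφ.center]; exact φ.left_inv hφ.mem_source
  have hg := pderiv_metricCoeff hn hF hcompat hφ.mem_atlas h0 hφ.orthonormal
  rw [hp] at hg
  set c := fun k i j => connSymbol cov φ k i j p with hc
  have hone : (Matrix.of fun a b => metricCoeff (averagedMetric F) φ a b 0) = 1 := by
    ext a b
    rw [Matrix.of_apply, hφ.orthonormal, Matrix.one_apply]
  have hLC : ∀ k i j, leviCivitaSymbol (averagedMetric F) φ k i j 0 =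
      1 / 2 * (c k i j + c j i k + (c k j i + c i j k) - (c j k i + c i k j)) := fun k i j => by
    simp only [leviCivitaSymbol, hone, inv_one, Matrix.one_apply, ite_mul, one_mul, zero_mul,
      Finset.sum_ite_eq, Finset.mem_univ, if_true, hg, hc]
  -- The geodesic equation at `t = 0` holds for every direction `a`, so polarization kills the
  -- symmetric symbols.
  have hzero : ∀ k i j, leviCivitaSymbol (averagedMetric F) φ k i j 0 = 0 := fun k i j => by
    refine eq_zero_of_quadratic_eq_zero (S := fun i j =>
      leviCivitaSymbol (averagedMetric F) φ k i j 0) (fun i j => ?_) (fun a => ?_) i j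
    · simp only [hLC]; ring
    · have := hφ.geodesic a 0 (by simpa using h0) k
      simpa using this
  -- The sum of these two Levi-Civita symbols is `∂_i γ_jk`, which is the required symmetrization of
  -- `c`.
  have h1 := hzero k i j
  have h2 := hzero j i k
  rw [hLC] at h1 h2
  change c k i j + c j i k = 0
  linarith

/-- Compatibility in coordinates: the horizontal derivatives of `F` vanish. -/
theorem dx_eq_sum [T2Space M] [cov.ContMDiffCovariantDerivative ∞]
    (hF : IsFinslerMetric F) (hcompat : IsCompatible F cov)
    (hφ : φ ∈ IsManifold.maximalAtlas (𝓡 n) ∞ M)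
    {x₀ : EuclideanSpace ℝ (Fin n)} (hx₀ : x₀ ∈ φ.target) {y : EuclideanSpace ℝ (Fin n)}
    (hy : y ≠ 0) (i : Fin n) :
    dx F φ i x₀ y = ∑ k, (∑ j, connSymbol cov φ k i j (φ.symm x₀) * y j) * dy F φ k x₀ y := by
  obtain ⟨A, hA0, hA, hAx⟩ := exists_isometric_transport (F := F) hcompat hφ hx₀
  have hf := ((contDiffAt_localF hF hφ hx₀ hy).differentiableAt (by simp)).hasFDerivAt
  set f' := fderiv ℝ (fun z : EuclideanSpace ℝ (Fin n) × EuclideanSpace ℝ (Fin n) =>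
      localF F φ z.1 z.2) (x₀, y)
  have hAy : HasFDerivAt (fun x => A x y)
      ((ContinuousLinearMap.apply ℝ (EuclideanSpace ℝ (Fin n)) y).comp
        (-christoffelMap cov φ x₀)) x₀ :=
    (ContinuousLinearMap.apply ℝ (EuclideanSpace ℝ (Fin n)) y).hasFDerivAt.comp x₀ hA
  have hpt : (x₀, y) = (x₀, A x₀ y) := by rw [hA0]; rfl
  have hcomp := HasFDerivAt.comp x₀ (hpt ▸ hf) ((hasFDerivAt_id x₀).prodMk hAy)
  -- Transport preserves `F`, so `x ↦ F(x, A x y)` is locally constant and the chain rule gives a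
  -- vanishing derivative.
  have hconst : (fun z : EuclideanSpace ℝ (Fin n) × EuclideanSpace ℝ (Fin n) =>
      localF F φ z.1 z.2) ∘ (fun x => (id x, A x y)) =ᶠ[𝓝 x₀] fun _ => localF F φ x₀ y := by
    filter_upwards [hAx] with x hx using hx.2.2 y
  have hz := hcomp.unique ((hasFDerivAt_const (localF F φ x₀ y) x₀).congr_of_eventuallyEq hconst)
  have hz1 := congrArg (fun T : EuclideanSpace ℝ (Fin n) →L[ℝ] ℝ => T (stdVec n i)) hz
  have hdx : dx F φ i x₀ y = f' (stdVec n i, 0) := by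
    have h1 : HasFDerivAt (fun x => localF F φ x y) (f'.comp
        ((ContinuousLinearMap.id ℝ _).prod 0)) x₀ :=
      HasFDerivAt.comp (f := fun x => (x, y)) x₀ hf
        ((hasFDerivAt_id x₀).prodMk (hasFDerivAt_const y x₀))
    rw [dx, pderiv, h1.fderiv]
    rfl
  have hdy : ∀ k, dy F φ k x₀ y = f' (0, stdVec n k) := fun k => by
    have h1 : HasFDerivAt (fun y => localF F φ x₀ y) (f'.comp
        (ContinuousLinearMap.prod 0 (ContinuousLinearMap.id ℝ _))) y :=
      HasFDerivAt.comp (f := fun y => (x₀, y)) y hf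
        ((hasFDerivAt_const x₀ y).prodMk (hasFDerivAt_id y))
    rw [dy, pderiv, h1.fderiv]
    rfl
  have hz2 : f' (stdVec n i, -(christoffelMap cov φ x₀ (stdVec n i) y)) = 0 := hz1
  have hsplit : ((stdVec n i, -(christoffelMap cov φ x₀ (stdVec n i) y)) :
      EuclideanSpace ℝ (Fin n) × EuclideanSpace ℝ (Fin n)) = (stdVec n i, 0) -
        ∑ k, christoffelMap cov φ x₀ (stdVec n i) y k • ((0, stdVec n k) :
          EuclideanSpace ℝ (Fin n) × EuclideanSpace ℝ (Fin n)) := by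
    refine Prod.ext ?_ ?_
    · simp [Prod.fst_sum]
    · simp [Prod.snd_sum, sum_smul_stdVec]
  rw [hsplit, map_sub, map_sum, sub_eq_zero, ← hdx] at hz2
  rw [hz2]
  refine Finset.sum_congr rfl fun k _ => ?_
  rw [map_smul, hdy, christoffelMap_stdVec, smul_eq_mul]

/-- The horizontal and the vertical contact functions at the centre of normal coordinates are
proportional, with factor `ρ`. -/
theorem fHor_eq_mul_fVert [T2Space M] [cov.ContMDiffCovariantDerivative ∞]
    (hn : 2 ≤ n) (hF : IsFinslerMetric F) (hcompat : IsCompatible F cov)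
    {ρ : (x : M) → TangentSpace (𝓡 n) x →L[ℝ] ℝ} (hρ : HasSemiSymmetricTorsion cov ρ) {p : M}
    (hφ : IsNormalChart (averagedMetric F) φ p) {y : EuclideanSpace ℝ (Fin n)} (hy : y ≠ 0)
    (i j : Fin n) :
    fHor F φ p j i y = (∑ m, ρ p (coordField φ m p) * y m) * fVert F φ p j i y := by
  have hsym := symbol_eq_of_skew_of_torsion (c := fun k i j => connSymbol cov φ k i j p)
    (connSymbol_skew_of_isNormalChart hn hF hcompat hφ)
    (connSymbol_sub_swap cov hφ.mem_atlas hφ.mem_source hρ)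
  have hdx : ∀ i, dx F φ i (φ p) y = (∑ m, ρ p (coordField φ m p) * y m) * dy F φ i (φ p) y -
      y i * ∑ k, ρ p (coordField φ k p) * dy F φ k (φ p) y := fun i => by
    have hinner : ∀ k, ∑ j, connSymbol cov φ k i j p * y j =
        (if k = i then ∑ m, ρ p (coordField φ m p) * y m else 0)
          - ρ p (coordField φ k p) * y i := fun k => by
      simp only [hsym, sub_mul, Finset.sum_sub_distrib]
      congr 1
      · split_ifs <;> simp
      · simp
    rw [dx_eq_sum hF hcompat hφ.mem_atlas (φ.mapsTo hφ.mem_source) hy,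
      φ.left_inv hφ.mem_source]
    simp only [hinner, sub_mul, Finset.sum_sub_distrib, ite_mul, zero_mul, Finset.sum_ite_eq',
      Finset.mem_univ, if_true, Finset.mul_sum]
    congr 1
    exact Finset.sum_congr rfl fun k _ => by ring
  -- The terms `y i * Σ ρ_k ∂F/∂yᵏ` cancel in the antisymmetrization.
  rw [fHor, fVert, hdx, hdx]
  ring

end NormalCoordinates

/-! ### Quadratic fibres and the existence of a vector that is not vertical contact. -/

section RiemannianFibers

variable {n : ℕ} {M : Type*} [TopologicalSpace M]
  [ChartedSpace (EuclideanSpace ℝ (Fin n)) M]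
  {φ : OpenPartialHomeomorph M (EuclideanSpace ℝ (Fin n))}
  {F : TangentBundle (𝓡 n) M → ℝ}

/-- `F²` is a quadratic form on the tangent space at `q`. -/
def IsQuadraticFiber (F : TangentBundle (𝓡 n) M → ℝ) (q : M) : Prop :=
  ∃ B : LinearMap.BilinForm ℝ (EuclideanSpace ℝ (Fin n)), B.IsSymm ∧
    ∀ y, fiberFun F q y ^ 2 = B y y

theorem IsQuadraticFiber.of_isometry {p q : M} (hp : IsQuadraticFiber F p)
    (L : EuclideanSpace ℝ (Fin n) ≃L[ℝ] EuclideanSpace ℝ (Fin n))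
    (hL : ∀ y, fiberFun F p (L y) = fiberFun F q y) : IsQuadraticFiber F q := by
  obtain ⟨B, hB, hFB⟩ := hp
  refine ⟨B.compl₁₂ L.toLinearMap L.toLinearMap, ⟨fun x y => hB.eq (L x) (L y)⟩, fun y => ?_⟩
  rw [← hL, hFB]
  rfl

variable [IsManifold (𝓡 n) ∞ M]

/-- Nearby fibres are linearly isometric, and being quadratic passes through an isometry in both
directions. -/
theorem isLocallyConstant_isQuadraticFiber [T2Space M]
    {cov : CovariantDerivative (𝓡 n) (EuclideanSpace ℝ (Fin n)) (TangentSpace (𝓡 n) : M → Type _)}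
    [cov.ContMDiffCovariantDerivative ∞] (hcompat : IsCompatible F cov) :
    IsLocallyConstant (IsQuadraticFiber F) := by
  rw [IsLocallyConstant.iff_eventually_eq]
  intro q
  have hφ := IsManifold.chart_mem_maximalAtlas (I := 𝓡 n) (n := ∞) q
  set φ := chartAt (EuclideanSpace ℝ (Fin n)) q
  have hq : q ∈ φ.source := mem_chart_source _ q
  obtain ⟨A, -, -, hA⟩ := exists_isometric_transport (F := F) hcompat hφ (φ.mapsTo hq)
  filter_upwards [(φ.continuousAt hq).eventually hA, φ.open_source.mem_nhds hq] with q' hq' hqs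
  obtain ⟨L, hL, -⟩ := exists_fiber_isometry hφ (φ.mapsTo hq) hq'.1 hq'.2.1 hq'.2.2
  rw [φ.left_inv hq, φ.left_inv hqs] at hL
  refine propext ⟨fun h => h.of_isometry L hL, fun h => h.of_isometry L.symm fun y => ?_⟩
  rw [← hL, L.apply_symm_apply]

theorem localF_smul (hF : IsFinslerMetric F) (x y : EuclideanSpace ℝ (Fin n)) {t : ℝ}
    (ht : 0 < t) : localF F φ x (t • y) = t * localF F φ x y :=
   (congrArg (fun v => F ⟨φ.symm x, v⟩)
    ((mfderiv (𝓡 n) (𝓡 n) φ.symm x).map_smul t y)).trans (hF.homogeneous _ _ t ht)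

/-- If the gradient of `F` at `y` is everywhere parallel to `y`, then `F` is a multiple of the
Euclidean norm in the given coordinates. -/
theorem exists_sq_localF_eq_mul_norm_sq (hn : 2 ≤ n) (hF : IsFinslerMetric F)
    (hφ : φ ∈ IsManifold.maximalAtlas (𝓡 n) ∞ M) {x : EuclideanSpace ℝ (Fin n)}
    (hx : x ∈ φ.target) (h : ∀ y ≠ 0, ∃ c : ℝ, ∀ i, dy F φ i x y = c * y i) :
    ∃ K : ℝ, ∀ y, localF F φ x y ^ 2 = K * ‖y‖ ^ 2 := by
  set f := localF F φ x with hf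
  have hdiff : ∀ y ≠ 0, HasFDerivAt f (fderiv ℝ f y) y := fun y hy => by
    have h1 : ContDiffAt ℝ ∞ f y := (contDiffAt_localF hF hφ hx hy).comp y
      (contDiffAt_const.prodMk contDiffAt_id)
    exact (h1.differentiableAt (by simp)).hasFDerivAt
  have hgrad : ∀ y ≠ 0, ∃ c : ℝ, fderiv ℝ f y = c • innerSL ℝ y := fun y hy => by
    obtain ⟨c, hc⟩ := h y hy
    refine ⟨c, ContinuousLinearMap.ext fun v => ?_⟩
    rw [← sum_smul_stdVec v, map_sum, map_sum]
    refine Finset.sum_congr rfl fun i _ => ?_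
    have h2 : fderiv ℝ f y (stdVec n i) = c * y i := hc i
    rw [map_smul, map_smul, h2]
    simp [stdVec, EuclideanSpace.inner_single_right]
  have heuler : ∀ y ≠ 0, fderiv ℝ f y y = f y := fun y hy => by
    have h1 : HasDerivAt (fun t : ℝ => f (t • y)) (fderiv ℝ f y y) 1 := by
      have h2 : HasDerivAt (fun t : ℝ => t • y) y 1 := by
        simpa using (hasDerivAt_id (1 : ℝ)).smul_const y
      have h5 : HasFDerivAt f (fderiv ℝ f y) ((1 : ℝ) • y) := by
        rw [one_smul]
        exact hdiff y hy
      exact h5.comp_hasDerivAt 1 h2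
    have h3 : HasDerivAt (fun t : ℝ => f (t • y)) (f y) 1 := by
      have h4 : HasDerivAt (fun t : ℝ => t * f y) (f y) 1 := by
        simpa using (hasDerivAt_id (1 : ℝ)).mul_const (f y)
      refine h4.congr_of_eventuallyEq ?_
      filter_upwards [lt_mem_nhds (zero_lt_one' ℝ)] with t ht using localF_smul hF x y ht
    exact h1.unique h3
  -- Euler's relation identifies `f y` with `c ‖y‖²`, where the gradient is `c y`; the two terms of
  -- the quotient rule then cancel.
  have hquot : ∀ y ≠ 0, HasFDerivAt (fun y => f y ^ 2 * (‖y‖ ^ 2)⁻¹)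
      (0 : EuclideanSpace ℝ (Fin n) →L[ℝ] ℝ) y := fun y hy => by
    obtain ⟨c, hc⟩ := hgrad y hy
    have hfy : f y = c * ‖y‖ ^ 2 := by
      rw [← heuler y hy, hc]
      simp
    have hny : ‖y‖ ^ 2 ≠ 0 := by simpa using hy
    refine (((hdiff y hy).pow 2).mul ((hasDerivAt_inv hny).comp_hasFDerivAt y
      (hasStrictFDerivAt_norm_sq y).hasFDerivAt)).congr_fderiv ?_
    ext v
    simp [hc, hfy]
    field_simp
    ring
  -- Dimension at least two makes the punctured space connected.
  have hrank : 1 < Module.rank ℝ (EuclideanSpace ℝ (Fin n)) := by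
    rw [← Module.finrank_eq_rank, finrank_euclideanSpace_fin]
    exact_mod_cast hn
  have hconn := (isConnected_compl_singleton_of_one_lt_rank hrank
    (0 : EuclideanSpace ℝ (Fin n))).isPreconnected
  have hconst : ∀ y ≠ 0, ∀ z ≠ 0, f y ^ 2 * (‖y‖ ^ 2)⁻¹ = f z ^ 2 * (‖z‖ ^ 2)⁻¹ := fun y hy z hz =>
    isOpen_compl_singleton.is_const_of_fderiv_eq_zero (𝕜 := ℝ)
      (f := fun y => f y ^ 2 * (‖y‖ ^ 2)⁻¹) hconn
      (fun w hw => (hquot w hw).differentiableAt.differentiableWithinAt)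
      (fun w hw => (hquot w hw).fderiv) hy hz
  have hne : stdVec n ⟨0, by omega⟩ ≠ 0 := by simp [stdVec]
  refine ⟨f (stdVec n ⟨0, by omega⟩) ^ 2 * (‖stdVec n ⟨0, by omega⟩‖ ^ 2)⁻¹, fun y => ?_⟩
  by_cases hy : y = 0
  · have h0 : f y = 0 := by
      rw [hy]
      exact (congrArg (fun v => F ⟨φ.symm x, v⟩)
        (map_zero (mfderiv (𝓡 n) (𝓡 n) φ.symm x))).trans ((hF.definite _ _).2 rfl)
    rw [h0, hy]
    simp
  · rw [← hconst y hy _ hne, inv_mul_cancel_right₀]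
    simpa using hy

/-- A non-Riemannian Finsler metric with a compatible connection has, in each tangent space, a
vector that is not vertical contact. -/
theorem exists_notVertContact [T2Space M] [ConnectedSpace M] (hn : 2 ≤ n)
    (hF : IsFinslerMetric F) (hnR : ¬ IsRiemannianFinsler F)
    {cov : CovariantDerivative (𝓡 n) (EuclideanSpace ℝ (Fin n)) (TangentSpace (𝓡 n) : M → Type _)}
    [cov.ContMDiffCovariantDerivative ∞] (hcompat : IsCompatible F cov)
    (hφ : φ ∈ IsManifold.maximalAtlas (𝓡 n) ∞ M) {p : M} (hp : p ∈ φ.source) :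
    ∃ v, NotVertContact F φ p v := by
  by_contra! hall
  have hpar : ∀ y ≠ 0, ∃ c : ℝ, ∀ i, dy F φ i (φ p) y = c * y i := fun y hy => by
    have h1 : ¬ LinearIndependent ℝ
        ![(fun i => dy F φ i (φ p) y : Fin n → ℝ), (fun i => y i : Fin n → ℝ)] :=
      fun h => hall y ⟨hy, h⟩
    have hy' : (fun i => y i : Fin n → ℝ) ≠ 0 := fun h => hy (by ext i; exact congrFun h i)
    rw [LinearIndependent.pair_symm_iff, LinearIndependent.pair_iff' hy'] at h1
    push Not at h1
    obtain ⟨c, hc⟩ := h1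
    exact ⟨c, fun i => (congrFun hc i).symm⟩
  obtain ⟨K, hK⟩ := exists_sq_localF_eq_mul_norm_sq hn hF hφ (φ.mapsTo hp) hpar
  have hquad : IsQuadraticFiber F p := by
    -- The form is `K` times the Euclidean product of the chart, moved to the tangent space by `D`.
    set D := chartSymmEquiv hφ (φ.mapsTo hp)
    refine ⟨K • (innerₗ (EuclideanSpace ℝ (Fin n))).compl₁₂ D.symm.toLinearMap
      D.symm.toLinearMap, ⟨fun y z => ?_⟩, fun y => ?_⟩
    · simp [real_inner_comm]
    · have h1 := hK (D.symm y)
      rw [localF_eq_fiberFun hφ F (φ.mapsTo hp), D.apply_symm_apply, φ.left_inv hp] at h1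
      rw [h1]
      simp
  refine hnR fun q => ?_
  have h := (isLocallyConstant_isQuadraticFiber hcompat).apply_eq_of_preconnectedSpace p q
  exact h.mp hquad

end RiemannianFibers

/-! ### Contact functions and the recovery of `ρ`. -/

section Contact

variable {n : ℕ} {M : Type*} [TopologicalSpace M]
  [ChartedSpace (EuclideanSpace ℝ (Fin n)) M]
  {φ : OpenPartialHomeomorph M (EuclideanSpace ℝ (Fin n))}
  {F : TangentBundle (𝓡 n) M → ℝ} {p : M}

/-- With `v m ≠ 0`, vanishing of the minors involving `m` would make the gradient `(∂F/∂yᵐ / v m) •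
v`. -/
theorem NotVertContact.exists_fVert_ne_zero {v : EuclideanSpace ℝ (Fin n)}
    (hv : NotVertContact F φ p v) : ∃ i j, fVert F φ p j i v ≠ 0 := by
  by_contra! hall
  obtain ⟨hv0, hind⟩ := hv
  obtain ⟨m, hm⟩ : ∃ m, v m ≠ 0 := by
    by_contra! h
    exact hv0 (by ext m; exact h m)
  have hv' : (fun i => v i : Fin n → ℝ) ≠ 0 := fun h => hm (congrFun h m)
  rw [LinearIndependent.pair_symm_iff, LinearIndependent.pair_iff' hv'] at hind
  refine hind (dy F φ m (φ p) v / v m) (funext fun i => ?_)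
  have h := hall i m
  rw [fVert] at h
  simp only [Pi.smul_apply, smul_eq_mul]
  field_simp
  linarith

-- It shows that non-vanishing of the contact function at `w_l` already forces `w_l ≠ 0`.
@[simp]
theorem fVert_zero (i j : Fin n) : fVert F φ p i j 0 = 0 := by
  simp [fVert]

theorem continuousAt_fVert [IsManifold (𝓡 n) ∞ M] (hF : IsFinslerMetric F)
    (hφ : φ ∈ IsManifold.maximalAtlas (𝓡 n) ∞ M) (hp : p ∈ φ.source)
    {v : EuclideanSpace ℝ (Fin n)} (hv : v ≠ 0) (i j : Fin n) :
    ContinuousAt (fVert F φ p i j) v := by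
  have hdy : ∀ k, ContinuousAt (fun y => dy F φ k (φ p) y) v := fun k => by
    have h1 : ContDiffAt ℝ ∞ (localF F φ (φ p)) v :=
      (contDiffAt_localF hF hφ (φ.mapsTo hp) hv).comp v (contDiffAt_const.prodMk contDiffAt_id)
    exact (h1.continuousAt_fderiv (by simp)).clm_apply continuousAt_const
  have hc : ∀ k, ContinuousAt (fun y : EuclideanSpace ℝ (Fin n) => y k) v := fun k => by fun_prop
  exact ((hc i).mul (hdy j)).sub ((hc j).mul (hdy i))

end Contact

/-- Weighting the equations by `v l` and summing isolates `(Σ v - ε) * Σ a v`. Dividing recovers `Σ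
a v`, and the `k`-th equation then gives `a k`. -/
theorem linear_component_eq {n : ℕ} {a v : Fin n → ℝ} {q : Fin n → ℝ} {ε : ℝ} (hε : ε ≠ 0)
    (hεv : ε ≠ ∑ m, v m) (hq : ∀ l, q l = ∑ m, a m * v m - ε * a l) (k : Fin n) :
    a k = 1 / ε * (1 / (∑ m, v m - ε) * ∑ l, v l * q l - q k) := by
  have hne : ∑ m, v m - ε ≠ 0 := sub_ne_zero.2 hεv.symm
  have hsum : ∑ l, v l * q l = (∑ m, v m - ε) * ∑ m, a m * v m := by
    have h : ∑ l, v l * (ε * a l) = ε * ∑ m, a m * v m := by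
      rw [Finset.mul_sum]
      exact Finset.sum_congr rfl fun m _ => by ring
    simp only [hq, mul_sub, Finset.sum_sub_distrib, ← Finset.sum_mul, h, sub_mul]
  rw [hsum, hq k]
  field_simp
  ring

end

theorem mainTheorem3 {n : ℕ} (hn : 2 ≤ n)
    {M : Type*} [TopologicalSpace M] [T2Space M] [SecondCountableTopology M] [ConnectedSpace M]
    [ChartedSpace (EuclideanSpace ℝ (Fin n)) M] [IsManifold (𝓡 n) ∞ M]
    (F : TangentBundle (𝓡 n) M → ℝ) (hF : IsFinslerMetric F) (hnR : ¬ IsRiemannianFinsler F)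
    (cov : CovariantDerivative (𝓡 n) (EuclideanSpace ℝ (Fin n)) (TangentSpace (𝓡 n) : M → Type _))
    [cov.ContMDiffCovariantDerivative ∞]
    (hcompat : IsCompatible F cov)
    (ρ : (x : M) → TangentSpace (𝓡 n) x →L[ℝ] ℝ)
    (hρ : HasSemiSymmetricTorsion cov ρ)
    (p : M) (φ : OpenPartialHomeomorph M (EuclideanSpace ℝ (Fin n)))
    (hφ : IsNormalChart (averagedMetric F) φ p) :
    (∃ v, NotVertContact F φ p v) ∧
    ∀ v, NotVertContact F φ p v →
      (∃ i j, fVert F φ p j i v ≠ 0) ∧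
      ∀ i j, fVert F φ p j i v ≠ 0 →
        (∃ r > 0, ∀ w ∈ Metric.closedBall v r, fVert F φ p j i w ≠ 0) ∧
        ∀ ε : ℝ, ε ≠ 0 → ε ≠ ∑ m, v m →
          (∀ l, fVert F φ p j i (v - ε • stdVec n l) ≠ 0) →
          ∀ k, ρ p (coordField φ k p) =
            1 / ε * (1 / (∑ m, v m - ε) *
              ∑ l, v l * (fHor F φ p j i (v - ε • stdVec n l)
                / fVert F φ p j i (v - ε • stdVec n l))
              - fHor F φ p j i (v - ε • stdVec n k) / fVert F φ p j i (v - ε • stdVec n k)) := by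
  refine ⟨exists_notVertContact hn hF hnR hcompat hφ.mem_atlas hφ.mem_source, fun v hv =>
    ⟨hv.exists_fVert_ne_zero, fun i j hij => ⟨?_, fun ε hε hεv hw => ?_⟩⟩⟩
  · obtain ⟨r, hr, hball⟩ := Metric.nhds_basis_closedBall.eventually_iff.1
      ((continuousAt_fVert hF hφ.mem_atlas hφ.mem_source hv.1 j i).eventually_ne hij)
    exact ⟨r, hr, fun w hw => hball hw⟩
  · refine linear_component_eq hε hεv fun l => ?_
    have hne : v - ε • stdVec n l ≠ 0 := fun h => hw l (by rw [h, fVert_zero])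
    -- The quotient is `ρ(w_l)`, and linearity gives `ρ(v) - ε ρ_l`.
    rw [fHor_eq_mul_fVert hn hF hcompat hρ hφ hne, mul_div_cancel_right₀ _ (hw l)]
    simp [stdVec, mul_sub, Finset.sum_sub_distrib, mul_comm ε]
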